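/- **Setting.** Asynchronous message passing with reliable point-to-point channels; clients and servers may crash. Clients are writers (a totally ordered set $\mathcal W$ of identifiers), readers and reconfiguration clients, three disjoint sets; each client runs one operation at a time. A set $\mathcal C$ of configuration identifiers is given; each $c\in\mathcal C$ has a finite set of servers and a set of quorums (subsets of its servers, any two of which intersect), and a consensus object $\mathrm{Con}_c$ with agreement (no two processes decide differently) and validity (a decided value has been proposed). Tags are pairs $(z,w)$ with $z\in\mathbb N$ and $w\in\mathcal W\cup\{\bot\}$ ($\bot$ least), ordered lexicographically; $t_0=(0,\bot)$; $v_0$ is the initial value of the object. Each configuration $c$ offers to the clients three data access primitives: $c.\text{get-tag}()$ returns a tag, $c.\text{get-data}()$ returns a tag-value pair, and $c.\text{put-data}(t,v)$ returns an acknowledgement; their implementation is arbitrary and may differ between configurations. **Algorithm ARES.** Every server has, for each configuration $c$, a variable $nextC$, initially $\bot$, else a pair $\langle d,\sigma\rangle$ with $d\in\mathcal C$ and status $\sigma\in\{P,F\}$. Every client has a sequence $cseq$ of such pairs, initially $\langle c_0,F\rangle$; $\mu$ denotes the largest index of an entry of $cseq$ with status $F$. - *put-config*$(c,e)$: send $e$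 to the servers of $c$ and wait until all servers of a quorum of $c$ have acknowledged this request; a server sets $nextC:=e$ for $c$ unless its $nextC$ for $c$ has status $F$, and acknowledges. - *read-next-config*$(c)$: request $nextC$ from the servers of $c$, wait until all servers of a quorum of $c$ have answered this request, and return a pair with status $F$ reported by this quorum if there is one, else a pair with status $P$ if there is one, else $\bot$. - *read-config*: starting at $i=\mu$, repeat: $e:=$ read-next-config$(cseq[i])$; if $e=\bot$, stop; otherwise set $cseq[i+1]:=e$, execute put-config$(cseq[i],e)$, and increase $i$ by one. - *write*$(v)$ by writer $w$: read-config; execute get-tag in the configurations $cseq[\mu],\dots,$ last, and let $(z,\cdot)$ be the maximum of $t_0$ and the tags returned; then, with $x=((z+1,w),v)$, repeat put-data$(x)$ in the last configuration of $cseq$ followed by read-config, until read-config leaves the length of $cseq$ unchanged. - *read*: read-config; execute get-data in the configurations $cseq[\mu],\dots,$ last; let $x=(t,v)$ be a pair of maximum tag among $(t_0,v_0)$ and the pairs returned; run the same loop as a write with $x$; return $v$. - *reconfig*$(c)$: read-config; let $c'$ be the last configuration in $cseq$; propose $c$ to $\mathrm{Con}_{c'}$ and let $d$ be the decision; append $\langle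 d,P\rangle$ to $cseq$ and execute put-config$(c',\langle d,P\rangle)$; execute get-data in the configurations $cseq[\mu],\dots,$ last, and put-data of a returned pair of maximum tag in $d$; set the status of the last entry of $cseq$ to $F$ and execute put-config$(c',\langle d,F\rangle)$. It is assumed that in an execution every configuration is introduced at most once: distinct reconfig operations are invoked with distinct configurations, none of which is $c_0$. **Consistency properties of the primitives** of a configuration $c$ in an execution $\xi$ (a primitive is complete if both its invocation and its response occur in $\xi$). - **C1.** If a complete $c.\text{put-data}(t,v)$ completes before a complete $c.\text{get-tag}$ or $c.\text{get-data}$ is invoked, then the tag returned by the latter is $\ge t$. - **C2.** If a complete $c.\text{get-data}$ returns $(t,v)$, then some $c.\text{put-data}(t,v)$ is invoked in $\xi$ before this get-data completes, or $(t,v)=(t_0,v_0)$. **Theorem.** ARES implements a (reconfigurable) atomic read/write object, provided that the primitives used in each configuration satisfy C1 and C2. That is, let $\xi$ be any finite or infinite execution of ARES in which, for every configuration $c$, the primitives of $c$ satisfy C1 and C2. Then there are a set $\Pi$, consisting of all complete read and write operations of $\xi$ and possibly some incomplete writes, and an irreflexive partial order $\prec$ on $\Pi$ such that: - **A1.** If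 $\pi_1,\pi_2\in\Pi$ and $\pi_1$ completes before $\pi_2$ is invoked, then not $\pi_2\prec\pi_1$. - **A2.** If $\pi\in\Pi$ is a write and $\pi'\in\Pi$ is another operation, then $\pi\prec\pi'$ or $\pi'\prec\pi$. - **A3.** A read in $\Pi$ returns the value written by the last write that precedes it in $\prec$, or $v_0$ if no write precedes it. No relation between the implementations of the primitives in different configurations is assumed. -/

import Mathlib

/-!
The algorithm ARES as an asynchronous message-passing transition system.

Type parameters used throughout: `S` servers, `C` configuration identifiers, `V` object values,
`W` writers, `R` readers, `G` reconfiguration clients.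
-/

namespace Ares

/-- Status of an entry of a configuration sequence: pending (`P`) or finalized (`F`). -/
inductive Status where
  | pending
  | finalized

/-- Tags `(z, w)`, ordered lexicographically.  The second component is a writer identifier, or the
symbol `⊥` that occurs in the initial tag. -/
abbrev Tag (W : Type*) := ℕ ×ₗ WithBot W

/-- The initial tag `(0, ⊥)`. -/
def tag0 (W : Type*) : Tag W := toLex (0, ⊥)

/-- The tag created by writer `w` from the tag `t`: the integer part is incremented. -/
def Tag.inc {W : Type*} (t : Tag W) (w : W) : Tag W := toLex ((ofLex t).1 + 1, (w : WithBot W))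

/-- The static data: member servers and quorums of each configuration, the initial configuration
and the initial value of the object.  Any two quorums of a configuration intersect. -/
structure System (S C V : Type*) where
  servers : C → Finset S
  quorums : C → Set (Finset S)
  quorum_subset : ∀ c, ∀ Q ∈ quorums c, Q ⊆ servers c
  quorum_inter : ∀ c, ∀ Q ∈ quorums c, ∀ Q' ∈ quorums c, ∃ s, s ∈ Q ∧ s ∈ Q'
  c0 : C
  v0 : V

/-- The clients: three disjoint sets of writers, readers and reconfiguration clients. -/
inductive Client (W R G : Type*) where
  | writer (w : W)
  | reader (r : R)
  | recon (g : G)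

/-- The operations offered to the clients. -/
inductive Op (C V : Type*) where
  | read
  | write (v : V)
  | reconfig (c : C)

/-- Which client may invoke which operation. -/
inductive MayInvoke {C V W R G : Type*} : Client W R G → Op C V → Prop where
  | read (r : R) : MayInvoke (.reader r) .read
  | write (w : W) (v : V) : MayInvoke (.writer w) (.write v)
  | reconfig (g : G) (c : C) : MayInvoke (.recon g) (.reconfig c)

/-- Invocations of the data access primitives of a configuration. -/
inductive DapCall (V W : Type*) where
  | getTag
  | getData
  | putData (t : Tag W) (v : V)

/-- Responses of the data access primitives of a configuration. -/
inductive DapRet (V W : Type*) where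
  | tag (t : Tag W)
  | pair (t : Tag W) (v : V)
  | ack

/-- An entry `⟨cfg, status⟩` of a configuration sequence. -/
abbrev Entry (C : Type*) := C × Status

/-- Messages.  Every request carries the client, the client's request number, the addressed
server and the configuration concerned; a reply repeats them. -/
inductive Msg (S C W R G : Type*) where
  | readConfig (p : Client W R G) (n : ℕ) (s : S) (c : C)
  | nextConfig (p : Client W R G) (n : ℕ) (s : S) (c : C) (x : Option (Entry C))
  | writeConfig (p : Client W R G) (n : ℕ) (s : S) (c : C) (e : Entry C)
  | ack (p : Client W R G) (n : ℕ) (s : S) (c : C)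

/-- Where a client continues when its current `read-config` returns: `opening op` for the
`read-config` at the start of operation `op`; `recheck op x ν` for the `read-config` in the final
loop of the read or write `op`, which propagates the pair `x` and for which the configuration
sequence had length `ν` at the preceding `put-data`. -/
inductive ReadCont (C V W : Type*) where
  | opening (op : Op C V)
  | recheck (op : Op C V) (x : Tag W × V) (ν : ℕ)

/-- Where a client continues when its current `put-config` returns: in the middle of
`read-config`, at the end of `add-config`, or at the end of `finalize-config`. -/
inductive PutCont (C V W : Type*) where
  | traverse (k : ReadCont C V W)
  | added (c : C)
  | finalizing

/-- The program counter of a client, with its local variables. An index `i` refers to the entry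
`cseq[i]`.
* `readConfig k`: about to execute `read-config(cseq)`.
* `readNext k i`: about to execute `read-next-config(cseq[i].cfg)`.
* `readNextWait k i ρ`: waiting for replies of a quorum; `ρ` are the replies so far.
* `readDone k`: `read-config` has returned.
* `putConfig a i`: about to execute `put-config(cseq[i].cfg, cseq[i+1])`.
* `putConfigWait a i A`: waiting for acknowledgements of a quorum; `A` are those so far.
* `getTag v i t`: in the query loop of `write(v)`, index `i` is next, `t` is the maximum so far.
* `getData op i M`: in the query loop of a read or in `update-config`, index `i` is next, `M` is
  the set of pairs gathered so far.
* `putData op x`: about to execute `put-data(x)` in the last configuration of `cseq`.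
* `propose c`, `proposeWait`: in `add-config`, before and after the proposal of `c`.
* `finalize`: about to execute `finalize-config(cseq)`.
* `returning r`: about to respond, with return value `r` (a value for reads only). -/
inductive Phase (S C V W : Type*) where
  | idle
  | readConfig (k : ReadCont C V W)
  | readNext (k : ReadCont C V W) (i : ℕ)
  | readNextWait (k : ReadCont C V W) (i : ℕ) (ρ : Set (S × Option (Entry C)))
  | readDone (k : ReadCont C V W)
  | putConfig (a : PutCont C V W) (i : ℕ)
  | putConfigWait (a : PutCont C V W) (i : ℕ) (A : Set S)
  | getTag (v : V) (i : ℕ) (t : Tag W)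
  | getTagWait (v : V) (i : ℕ) (t : Tag W)
  | getData (op : Op C V) (i : ℕ) (M : Set (Tag W × V))
  | getDataWait (op : Op C V) (i : ℕ) (M : Set (Tag W × V))
  | putData (op : Op C V) (x : Tag W × V)
  | putDataWait (op : Op C V) (x : Tag W × V)
  | propose (c : C)
  | proposeWait (c : C)
  | finalize
  | returning (r : Option V)

/-- The state of one client: its configuration sequence, the number of requests it has broadcast,
and its program counter. -/
structure Local (S C V W : Type*) where
  cseq : List (Entry C)
  rid : ℕ
  phase : Phase S C V W

/-- A global state: the clients, the messages in transit, the variable `nextC` of each server for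
each configuration, and the consensus instance of each configuration (values proposed so far, and
the decision if there is one). -/
structure State (S C V W R G : Type*) where
  client : Client W R G → Local S C V W
  net : Set (Msg S C W R G)
  nextC : S → C → Option (Entry C)
  proposed : C → Set C
  decided : C → Option C

open Classical in
/-- Change the state of client `p`. -/
noncomputable def State.setClient {S C V W R G : Type*} (σ : State S C V W R G)
    (p : Client W R G) (l : Local S C V W) : State S C V W R G :=
  { σ with client := Function.update σ.client p l }

/-- Change the program counter of client `p`. -/
noncomputable def State.goto {S C V W R G : Type*} (σ : State S C V W R G)
    (p : Client W R G) (φ : Phase S C V W) : State S C V W R G :=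
  σ.setClient p { σ.client p with phase := φ }

/-- Change the configuration sequence and the program counter of client `p`. -/
noncomputable def State.gotoWith {S C V W R G : Type*} (σ : State S C V W R G)
    (p : Client W R G) (l : List (Entry C)) (φ : Phase S C V W) : State S C V W R G :=
  σ.setClient p { σ.client p with cseq := l, phase := φ }

/-- Client `p` sends a set of messages, under a fresh request number, and waits. -/
noncomputable def State.broadcast {S C V W R G : Type*} (σ : State S C V W R G)
    (p : Client W R G) (m : Set (Msg S C W R G)) (φ : Phase S C V W) : State S C V W R G :=
  { σ.setClient p { σ.client p with rid := (σ.client p).rid + 1, phase := φ } with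
    net := σ.net ∪ m }

/-- Replace message `m` in transit by message `m'`. -/
def State.reply {S C V W R G : Type*} (σ : State S C V W R G) (m m' : Msg S C W R G) :
    State S C V W R G :=
  { σ with net := (σ.net \ {m}) ∪ {m'} }

/-- Message `m` is delivered. -/
def State.consume {S C V W R G : Type*} (σ : State S C V W R G) (m : Msg S C W R G) :
    State S C V W R G :=
  { σ with net := σ.net \ {m} }

open Classical in
/-- Server `s` assigns `e` to its variable `nextC` for configuration `c`. -/
noncomputable def State.setNext {S C V W R G : Type*} (σ : State S C V W R G) (s : S) (c : C)
    (e : Entry C) : State S C V W R G :=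
  { σ with nextC := Function.update σ.nextC s (Function.update (σ.nextC s) c (some e)) }

open Classical in
/-- The value `d` is proposed to the consensus instance of configuration `c`. -/
noncomputable def State.addProposal {S C V W R G : Type*} (σ : State S C V W R G) (c d : C) :
    State S C V W R G :=
  { σ with proposed := Function.update σ.proposed c (insert d (σ.proposed c)) }

open Classical in
/-- The consensus instance of configuration `c` has decided the value `d`. -/
noncomputable def State.setDecision {S C V W R G : Type*} (σ : State S C V W R G) (c d : C) :
    State S C V W R G :=
  { σ with decided := Function.update σ.decided c (some d) }

/-- `μ` is the largest index of a finalized entry of `l`. -/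
def IsLastFinal {C : Type*} (l : List (Entry C)) (μ : ℕ) : Prop :=
  (∃ c, l[μ]? = some (c, Status.finalized)) ∧
    ∀ j c, l[j]? = some (c, Status.finalized) → j ≤ μ

/-- The assignment `l[i] ← e`, which extends the sequence by one entry if `i` is its length. -/
def assign {C : Type*} (l : List (Entry C)) (i : ℕ) (e : Entry C) : List (Entry C) :=
  l.take i ++ e :: l.drop (i + 1)

/-- The result of `read-next-config` from the replies `ρ`, when all servers of `Q` have replied:
a finalized entry if one is reported by `Q`, else a pending entry if one is reported, else `⊥`. -/
inductive NextOutcome {S C : Type*} (ρ : Set (S × Option (Entry C))) (Q : Finset S) :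
    Option (Entry C) → Prop where
  | fin (s : S) (d : C) (hs : s ∈ Q) (h : (s, some (d, Status.finalized)) ∈ ρ) :
      NextOutcome ρ Q (some (d, Status.finalized))
  | pend (s : S) (d : C) (hs : s ∈ Q) (h : (s, some (d, Status.pending)) ∈ ρ)
      (hno : ∀ s' ∈ Q, ∀ d', (s', some (d', Status.finalized)) ∉ ρ) :
      NextOutcome ρ Q (some (d, Status.pending))
  | bot (h : ∀ s ∈ Q, ∀ e, (s, some e) ∉ ρ) : NextOutcome ρ Q none

/-- The return value of a read or write which propagated the pair `x`. -/
def Op.result {C V W : Type*} : Op C V → Tag W × V → Option V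
  | .read, x => some x.2
  | _, _ => none

/-- Labels of steps: operations are invoked and return, data access primitives of a configuration
are invoked and return; all other steps are internal. -/
inductive Act (C V W R G : Type*) where
  | invoke (p : Client W R G) (op : Op C V)
  | respond (p : Client W R G) (r : Option V)
  | dapInvoke (p : Client W R G) (c : C) (call : DapCall V W)
  | dapRespond (p : Client W R G) (c : C) (ret : DapRet V W)
  | internal

/-- The steps of ARES.  Channels are asynchronous and not FIFO.  The data access primitives are
an external service: their responses are entirely unconstrained here, so that the executions below
include those obtained with any implementation of the primitives, possibly a different one in each
configuration.  The consensus instances are linearized objects satisfying agreement and validity.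
A crashed client or server is one that takes no further step. -/
inductive Step {S C V W R G : Type*} [LinearOrder W] (A : System S C V) :
    State S C V W R G → Act C V W R G → State S C V W R G → Prop where
  /- nothing happens -/
  | stutter (σ) : Step A σ .internal σ
  /- start and end of operations -/
  | invoke (σ p op) (hp : (σ.client p).phase = .idle) (hop : MayInvoke p op) :
      Step A σ (.invoke p op) (σ.goto p (.readConfig (.opening op)))
  | respond (σ p r) (hp : (σ.client p).phase = .returning r) :
      Step A σ (.respond p r) (σ.goto p .idle)
  /- read-config -/
  | readConfig (σ p k μ) (hp : (σ.client p).phase = .readConfig k)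
      (hμ : IsLastFinal (σ.client p).cseq μ) :
      Step A σ .internal (σ.goto p (.readNext k μ))
  | readNext (σ p k i e) (hp : (σ.client p).phase = .readNext k i)
      (he : (σ.client p).cseq[i]? = some e) :
      Step A σ .internal
        (σ.broadcast p
          {m | ∃ s ∈ A.servers e.1, m = .readConfig p ((σ.client p).rid + 1) s e.1}
          (.readNextWait k i ∅))
  | readNextReply (σ p k i ρ n s c x) (hp : (σ.client p).phase = .readNextWait k i ρ)
      (hn : (σ.client p).rid = n) (hm : .nextConfig p n s c x ∈ σ.net) :
      Step A σ .internal
        ((σ.consume (.nextConfig p n s c x)).goto p (.readNextWait k i (insert (s, x) ρ)))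
  | readNextSome (σ p k i ρ e Q e') (hp : (σ.client p).phase = .readNextWait k i ρ)
      (he : (σ.client p).cseq[i]? = some e) (hQ : Q ∈ A.quorums e.1)
      (hall : ∀ s ∈ Q, ∃ x, (s, x) ∈ ρ) (hout : NextOutcome ρ Q (some e')) :
      Step A σ .internal
        (σ.gotoWith p (assign (σ.client p).cseq (i + 1) e') (.putConfig (.traverse k) i))
  | readNextNone (σ p k i ρ e Q) (hp : (σ.client p).phase = .readNextWait k i ρ)
      (he : (σ.client p).cseq[i]? = some e) (hQ : Q ∈ A.quorums e.1)
      (hall : ∀ s ∈ Q, ∃ x, (s, x) ∈ ρ) (hout : NextOutcome ρ Q none) :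
      Step A σ .internal (σ.goto p (.readDone k))
  /- put-config -/
  | putConfig (σ p a i e e') (hp : (σ.client p).phase = .putConfig a i)
      (he : (σ.client p).cseq[i]? = some e) (he' : (σ.client p).cseq[i + 1]? = some e') :
      Step A σ .internal
        (σ.broadcast p
          {m | ∃ s ∈ A.servers e.1, m = .writeConfig p ((σ.client p).rid + 1) s e.1 e'}
          (.putConfigWait a i ∅))
  | putConfigAck (σ p a i B n s c) (hp : (σ.client p).phase = .putConfigWait a i B)
      (hn : (σ.client p).rid = n) (hm : .ack p n s c ∈ σ.net) :
      Step A σ .internal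
        ((σ.consume (.ack p n s c)).goto p (.putConfigWait a i (insert s B)))
  | putConfigTraverse (σ p k i B e Q) (hp : (σ.client p).phase = .putConfigWait (.traverse k) i B)
      (he : (σ.client p).cseq[i]? = some e) (hQ : Q ∈ A.quorums e.1) (hall : ∀ s ∈ Q, s ∈ B) :
      Step A σ .internal (σ.goto p (.readNext k (i + 1)))
  | putConfigAdded (σ p c i B e Q μ) (hp : (σ.client p).phase = .putConfigWait (.added c) i B)
      (he : (σ.client p).cseq[i]? = some e) (hQ : Q ∈ A.quorums e.1) (hall : ∀ s ∈ Q, s ∈ B)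
      (hμ : IsLastFinal (σ.client p).cseq μ) :
      Step A σ .internal (σ.goto p (.getData (.reconfig c) μ ∅))
  | putConfigFinalizing (σ p i B e Q)
      (hp : (σ.client p).phase = .putConfigWait .finalizing i B)
      (he : (σ.client p).cseq[i]? = some e) (hQ : Q ∈ A.quorums e.1) (hall : ∀ s ∈ Q, s ∈ B) :
      Step A σ .internal (σ.goto p (.returning none))
  /- servers -/
  | serverRead (σ p n s c) (hm : .readConfig p n s c ∈ σ.net) :
      Step A σ .internal
        (σ.reply (.readConfig p n s c) (.nextConfig p n s c (σ.nextC s c)))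
  | serverWrite (σ p n s c e) (hm : .writeConfig p n s c e ∈ σ.net)
      (h : ∀ d, σ.nextC s c ≠ some (d, Status.finalized)) :
      Step A σ .internal
        ((σ.setNext s c e).reply (.writeConfig p n s c e) (.ack p n s c))
  | serverKeep (σ p n s c e d) (hm : .writeConfig p n s c e ∈ σ.net)
      (h : σ.nextC s c = some (d, Status.finalized)) :
      Step A σ .internal (σ.reply (.writeConfig p n s c e) (.ack p n s c))
  /- write: query the tags of the configurations from the last finalized one on -/
  | writeStart (σ p v μ) (hp : (σ.client p).phase = .readDone (.opening (.write v)))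
      (hμ : IsLastFinal (σ.client p).cseq μ) :
      Step A σ .internal (σ.goto p (.getTag v μ (tag0 W)))
  | getTagInvoke (σ p v i t e) (hp : (σ.client p).phase = .getTag v i t)
      (he : (σ.client p).cseq[i]? = some e) :
      Step A σ (.dapInvoke p e.1 .getTag) (σ.goto p (.getTagWait v i t))
  | getTagRespond (σ p v i t e t') (hp : (σ.client p).phase = .getTagWait v i t)
      (he : (σ.client p).cseq[i]? = some e) :
      Step A σ (.dapRespond p e.1 (.tag t')) (σ.goto p (.getTag v (i + 1) (max t' t)))
  | getTagEnd (σ w v t)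
      (hp : (σ.client (.writer w)).phase =
        .getTag v (σ.client (.writer w)).cseq.length t) :
      Step A σ .internal (σ.goto (.writer w) (.putData (.write v) (Tag.inc t w, v)))
  /- read and update-config: query the pairs of the configurations from the last finalized one on,
     and choose a pair with the maximum tag -/
  | readStart (σ p μ) (hp : (σ.client p).phase = .readDone (.opening .read))
      (hμ : IsLastFinal (σ.client p).cseq μ) :
      Step A σ .internal (σ.goto p (.getData .read μ {(tag0 W, A.v0)}))
  | getDataInvoke (σ p op i M e) (hp : (σ.client p).phase = .getData op i M)
      (he : (σ.client p).cseq[i]? = some e) :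
      Step A σ (.dapInvoke p e.1 .getData) (σ.goto p (.getDataWait op i M))
  | getDataRespond (σ p op i M e t v) (hp : (σ.client p).phase = .getDataWait op i M)
      (he : (σ.client p).cseq[i]? = some e) :
      Step A σ (.dapRespond p e.1 (.pair t v))
        (σ.goto p (.getData op (i + 1) (insert (t, v) M)))
  | getDataEnd (σ p op M x)
      (hp : (σ.client p).phase = .getData op (σ.client p).cseq.length M)
      (hx : x ∈ M) (hmax : ∀ y ∈ M, y.1 ≤ x.1) :
      Step A σ .internal (σ.goto p (.putData op x))
  /- put-data in the last configuration -/
  | putDataInvoke (σ p op x e) (hp : (σ.client p).phase = .putData op x)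
      (he : (σ.client p).cseq.getLast? = some e) :
      Step A σ (.dapInvoke p e.1 (.putData x.1 x.2)) (σ.goto p (.putDataWait op x))
  | putDataRespondRead (σ p x e) (hp : (σ.client p).phase = .putDataWait .read x)
      (he : (σ.client p).cseq.getLast? = some e) :
      Step A σ (.dapRespond p e.1 .ack)
        (σ.goto p (.readConfig (.recheck .read x (σ.client p).cseq.length)))
  | putDataRespondWrite (σ p v x e) (hp : (σ.client p).phase = .putDataWait (.write v) x)
      (he : (σ.client p).cseq.getLast? = some e) :
      Step A σ (.dapRespond p e.1 .ack)
        (σ.goto p (.readConfig (.recheck (.write v) x (σ.client p).cseq.length)))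
  | putDataRespondReconfig (σ p c x e)
      (hp : (σ.client p).phase = .putDataWait (.reconfig c) x)
      (he : (σ.client p).cseq.getLast? = some e) :
      Step A σ (.dapRespond p e.1 .ack) (σ.goto p .finalize)
  /- read and write: end if no new configuration was found, else propagate again -/
  | recheckEnd (σ p op x ν) (hp : (σ.client p).phase = .readDone (.recheck op x ν))
      (hν : (σ.client p).cseq.length = ν) :
      Step A σ .internal (σ.goto p (.returning (op.result x)))
  | recheckLoop (σ p op x ν) (hp : (σ.client p).phase = .readDone (.recheck op x ν))
      (hν : (σ.client p).cseq.length ≠ ν) :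
      Step A σ .internal (σ.goto p (.putData op x))
  /- add-config -/
  | reconfigStart (σ p c) (hp : (σ.client p).phase = .readDone (.opening (.reconfig c))) :
      Step A σ .internal (σ.goto p (.propose c))
  | propose (σ p c e) (hp : (σ.client p).phase = .propose c)
      (he : (σ.client p).cseq.getLast? = some e) :
      Step A σ .internal ((σ.addProposal e.1 c).goto p (.proposeWait c))
  | decide (σ p c e d) (hp : (σ.client p).phase = .proposeWait c)
      (he : (σ.client p).cseq.getLast? = some e)
      (hvalid : d ∈ σ.proposed e.1) (hagree : σ.decided e.1 = none ∨ σ.decided e.1 = some d) :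
      Step A σ .internal
        ((σ.setDecision e.1 d).gotoWith p ((σ.client p).cseq ++ [(d, Status.pending)])
          (.putConfig (.added c) ((σ.client p).cseq.length - 1)))
  /- finalize-config -/
  | finalize (σ p i e) (hp : (σ.client p).phase = .finalize)
      (hi : (σ.client p).cseq.length = i + 2) (he : (σ.client p).cseq[i + 1]? = some e) :
      Step A σ .internal
        (σ.gotoWith p (assign (σ.client p).cseq (i + 1) (e.1, Status.finalized))
          (.putConfig .finalizing i))

/-- The initial state. -/
def initState {S C V : Type*} (W R G : Type*) (A : System S C V) : State S C V W R G where
  client := fun _ => { cseq := [(A.c0, Status.finalized)], rid := 0, phase := .idle }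
  net := ∅
  nextC := fun _ _ => none
  proposed := fun _ => ∅
  decided := fun _ => none

/-- An execution of ARES: `act n` is the label of the step from `state n` to `state (n + 1)`.
Finite executions are included, by stuttering forever. -/
structure Execution {S C V : Type*} (W R G : Type*) [LinearOrder W] (A : System S C V) where
  state : ℕ → State S C V W R G
  act : ℕ → Act C V W R G
  init : state 0 = initState W R G A
  step : ∀ n, Step A (state n) (act n) (state (n + 1))

namespace Execution

variable {S C V W R G : Type*} [LinearOrder W] {A : System S C V}

/-- Every configuration is attempted to be introduced at most once: reconfigurations are invoked
with pairwise distinct configurations, different from the initial one. -/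
def DistinctReconfigs (ξ : Execution W R G A) : Prop :=
  (∀ i j p q c, ξ.act i = .invoke p (.reconfig c) → ξ.act j = .invoke q (.reconfig c) → i = j) ∧
    ∀ i p, ξ.act i ≠ .invoke p (.reconfig A.c0)

/-- A complete data access primitive of configuration `c`: invoked by `p` in step `i` with
response `ret` in step `j`. -/
def CompleteDap (ξ : Execution W R G A) (c : C) (p : Client W R G) (call : DapCall V W)
    (ret : DapRet V W) (i j : ℕ) : Prop :=
  ξ.act i = .dapInvoke p c call ∧ i < j ∧ ξ.act j = .dapRespond p c ret ∧
    ∀ k, i < k → k < j → ∀ ret', ξ.act k ≠ .dapRespond p c ret'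

/-- Property C1 of the primitives of configuration `c`: a `get-tag` or `get-data` invoked after
the completion of a `put-data` returns at least the tag of the latter. -/
def C1 (ξ : Execution W R G A) (c : C) : Prop :=
  ∀ (p q : Client W R G) (t : Tag W) (v : V) (i j i' j' : ℕ),
    ξ.CompleteDap c p (.putData t v) .ack i j → j < i' →
      (∀ t', ξ.CompleteDap c q .getTag (.tag t') i' j' → t ≤ t') ∧
        (∀ t' v', ξ.CompleteDap c q .getData (.pair t' v') i' j' → t ≤ t')

/-- Property C2 of the primitives of configuration `c`: a pair returned by `get-data` is the
argument of a `put-data` invoked before that `get-data` completes, or the initial pair. -/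
def C2 (ξ : Execution W R G A) (c : C) : Prop :=
  ∀ (p : Client W R G) (t : Tag W) (v : V) (i j : ℕ),
    ξ.CompleteDap c p .getData (.pair t v) i j →
      (∃ q i', i' < j ∧ ξ.act i' = .dapInvoke q c (.putData t v)) ∨ (t, v) = (tag0 W, A.v0)

/-- Operations are identified with the step of their invocation. `ξ.Complete op r i j`: the
operation `op` invoked in step `i` returns `r` in step `j`. -/
def Complete (ξ : Execution W R G A) (op : Op C V) (r : Option V) (i j : ℕ) : Prop :=
  ∃ p, ξ.act i = .invoke p op ∧ i < j ∧ ξ.act j = .respond p r ∧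
    ∀ k, i < k → k < j → ∀ r', ξ.act k ≠ .respond p r'

/-- The operation invoked in step `i` is a write of `v`. -/
def IsWrite (ξ : Execution W R G A) (i : ℕ) (v : V) : Prop :=
  ∃ p, ξ.act i = .invoke p (.write v)

/-- The operation invoked in step `i` is a complete read that returns `v`. -/
def ReadReturns (ξ : Execution W R G A) (i : ℕ) (v : V) : Prop :=
  ∃ j, ξ.Complete .read (some v) i j

/-- The operation invoked in step `i` is complete before the operation invoked in step `i'`
is invoked. -/
def Precedes (ξ : Execution W R G A) (i i' : ℕ) : Prop :=
  ∃ op r j, ξ.Complete op r i j ∧ j < i'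

/-- Atomicity of the read/write object: there are a set `Ops` that consists of all complete reads,
all complete writes, and possibly some incomplete writes, and an irreflexive partial order on it
with the properties A1, A2, A3. -/
def Atomic (ξ : Execution W R G A) : Prop :=
  ∃ (Ops : Set ℕ) (prec : ℕ → ℕ → Prop),
    (∀ i ∈ Ops, (∃ v, ξ.ReadReturns i v) ∨ ∃ v, ξ.IsWrite i v) ∧
    (∀ i j r, ξ.Complete .read r i j → i ∈ Ops) ∧
    (∀ i j v r, ξ.Complete (.write v) r i j → i ∈ Ops) ∧
    (∀ a ∈ Ops, ¬ prec a a) ∧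
    (∀ a ∈ Ops, ∀ b ∈ Ops, ∀ c ∈ Ops, prec a b → prec b c → prec a c) ∧
    -- A1
    (∀ a ∈ Ops, ∀ b ∈ Ops, ξ.Precedes a b → ¬ prec b a) ∧
    -- A2
    (∀ a ∈ Ops, ∀ b ∈ Ops, a ≠ b → (∃ v, ξ.IsWrite a v) → prec a b ∨ prec b a) ∧
    -- A3
    (∀ b ∈ Ops, ∀ v, ξ.ReadReturns b v →
      (∃ a ∈ Ops, ξ.IsWrite a v ∧ prec a b ∧
          ∀ a' ∈ Ops, (∃ v', ξ.IsWrite a' v') → prec a' b → a' = a ∨ prec a' a) ∨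
        (v = A.v0 ∧ ∀ a' ∈ Ops, (∃ v', ξ.IsWrite a' v') → ¬ prec a' b))

end Execution

end Ares

/-!
# Atomicity of ARES

The operations are ordered by the tags that they propagate, a write coming before the reads with the
same tag.  Different writes have different tags, and by C2 every pair in circulation is the initial
pair or the pair of a write, so atomicity reduces to one fact (`HasPair.le_of_precedes`): if an
operation with tag `t` is complete before another one is invoked, then the query of the latter finds
a tag `≥ t`.

*The chain.*  Consensus decides one successor for each configuration.  Since a configuration is
proposed by at most one reconfiguration, hence to at most one consensus instance, the successor
function is injective and does not reach the initial configuration.  So the configurations form a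
chain without repetition (`At.unique`, `At.inj`), and all clients know initial segments of it.

*Quorums.*  A client moves past a configuration of its sequence only after a quorum has stored the
successor.  A `read-config` therefore ends at the last entry of the sequence, where a quorum has
answered `⊥` (`ClientInv.fresh`).  By quorum intersection (`QuorumSet.gt_of_unset`), whatever
happened before such a `read-config` happened before any quorum of that configuration knew its
successor.  In particular a read or write with tag `t` has completed a `put-data` of `t` in its last
configuration `c` before any quorum of `c` knew the successor of `c`.

*Finalized configurations.*  It follows that every finalized configuration `d` beyond `c` has
received a tag `≥ t` (`Finalized.put`).  Indeed the reconfiguration that finalized `d` queried all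
configurations from a previously finalized one up to `d`, at a time when a quorum of `c` knew the
successor of `c`.  If it queried `c`, it found a tag `≥ t` by C1; otherwise it started from a
finalized configuration strictly between `c` and `d`, and induction applies.  The same alternative,
applied to the query of a later operation, gives the fact stated above (`Query.exists_le`).

These facts about the history of an execution are consequences of an invariant (`Inv`) that states
for each program counter of a client what must have happened before.
-/

namespace Ares

/-! ### Effects of single steps -/

section StateUpdates

variable {S C V W R G : Type*}

/-- The client that takes an externally visible step. -/
def Act.actor : Act C V W R G → Option (Client W R G)
  | .invoke p _ => some p
  | .respond p _ => some p
  | .dapInvoke p _ _ => some p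
  | .dapRespond p _ _ => some p
  | .internal => none

variable (σ : State S C V W R G) (p : Client W R G)

open Classical in
theorem State.goto_client (φ : Phase S C V W) : (σ.goto p φ).client =
    Function.update σ.client p { σ.client p with phase := φ } := rfl

open Classical in
theorem State.gotoWith_client (l : List (Entry C)) (φ : Phase S C V W) :
    (σ.gotoWith p l φ).client =
      Function.update σ.client p { σ.client p with cseq := l, phase := φ } := rfl

open Classical in
theorem State.broadcast_client (m : Set (Msg S C W R G)) (φ : Phase S C V W) :
    (σ.broadcast p m φ).client =
      Function.update σ.client p { σ.client p with rid := (σ.client p).rid + 1, phase := φ } := rfl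

theorem State.reply_client (m m' : Msg S C W R G) : (σ.reply m m').client = σ.client := rfl

theorem State.consume_client (m : Msg S C W R G) : (σ.consume m).client = σ.client := rfl

theorem State.setNext_client (s : S) (c : C) (e : Entry C) :
    (σ.setNext s c e).client = σ.client := rfl

theorem State.addProposal_client (c d : C) : (σ.addProposal c d).client = σ.client := rfl

theorem State.setDecision_client (c d : C) : (σ.setDecision c d).client = σ.client := rfl

end StateUpdates

section Monotonicity

variable {S C V W R G : Type*} [LinearOrder W] {A : System S C V}
  {σ σ' : State S C V W R G} {a : Act C V W R G}

theorem Step.rid_le (h : Step A σ a σ') (p : Client W R G) :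
    (σ.client p).rid ≤ (σ'.client p).rid := by
  classical
  cases h <;>
    simp only [State.goto_client, State.gotoWith_client, State.broadcast_client,
      State.reply_client, State.consume_client, State.setNext_client, State.addProposal_client,
      State.setDecision_client, Function.update_apply, le_refl] <;>
    split_ifs with hq <;> first | exact le_rfl | (subst hq; simp)

theorem Step.decided_mono (h : Step A σ a σ') {c d : C} (hd : σ.decided c = some d) :
    σ'.decided c = some d := by
  classical
  cases h
  case decide p c' e d' hp he hv hag =>
    change Function.update σ.decided e.1 (some d') c = some d
    rw [Function.update_apply]
    split_ifs with hc
    · subst hc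
      rw [hd] at hag
      simpa [eq_comm] using hag
    · exact hd
  all_goals exact hd

theorem Step.nextC_ne_none (h : Step A σ a σ') {s : S} {c : C} (hd : σ.nextC s c ≠ none) :
    σ'.nextC s c ≠ none := by
  classical
  cases h
  case serverWrite p n s' c' e hm hf =>
    change Function.update σ.nextC s' (Function.update (σ.nextC s') c' (some e)) s c ≠ none
    rw [Function.update_apply]
    split_ifs with hs
    · subst hs
      rw [Function.update_apply]
      split_ifs
      · simp
      · exact hd
    · exact hd
  all_goals exact hd

theorem Step.proposed_mono (h : Step A σ a σ') {c d : C} (hd : d ∈ σ.proposed c) :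
    d ∈ σ'.proposed c := by
  classical
  cases h
  case propose p c' e hp he =>
    change d ∈ Function.update σ.proposed e.1 (insert c' (σ.proposed e.1)) c
    rw [Function.update_apply]
    split_ifs with hc
    · subst hc
      exact Set.mem_insert_of_mem _ hd
    · exact hd
  all_goals exact hd

end Monotonicity

namespace Execution

variable {S C V W R G : Type*} [LinearOrder W] {A : System S C V} (ξ : Execution W R G A)

theorem rid_mono (p : Client W R G) : Monotone fun n => ((ξ.state n).client p).rid :=
  monotone_nat_of_le_succ fun n => (ξ.step n).rid_le p

variable {ξ}

theorem decided_mono {m n : ℕ} (h : m ≤ n) {c d : C} (hd : (ξ.state m).decided c = some d) :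
    (ξ.state n).decided c = some d := by
  induction h with
  | refl => exact hd
  | step _ ih => exact (ξ.step _).decided_mono ih

theorem nextC_ne_none_mono {m n : ℕ} (h : m ≤ n) {s : S} {c : C}
    (hd : (ξ.state m).nextC s c ≠ none) : (ξ.state n).nextC s c ≠ none := by
  induction h with
  | refl => exact hd
  | step _ ih => exact (ξ.step _).nextC_ne_none ih

end Execution

/-! ### Consensus and the chain of configurations -/

section Proposals

variable {S C V W R G : Type*}

/-- The configuration that a reconfiguration in its opening `read-config` will propose. -/
def ReadCont.toPropose : ReadCont C V W → Option C
  | .opening (.reconfig c) => some c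
  | _ => none

/-- The configuration that a client will propose after this `put-config`, if any. -/
def PutCont.toPropose : PutCont C V W → Option C
  | .traverse k => k.toPropose
  | _ => none

/-- The configuration that a client in this phase is still going to propose, if any. -/
def Phase.toPropose : Phase S C V W → Option C
  | .readConfig k => k.toPropose
  | .readNext k _ => k.toPropose
  | .readNextWait k _ _ => k.toPropose
  | .readDone k => k.toPropose
  | .putConfig a _ => a.toPropose
  | .putConfigWait a _ _ => a.toPropose
  | .propose c => some c
  | _ => none

variable [LinearOrder W] {A : System S C V} {σ σ' : State S C V W R G} {a : Act C V W R G}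

/-- A client is about to propose a configuration only if it was so before, or if it has just
invoked a reconfiguration. -/
theorem Step.toPropose (h : Step A σ a σ') {p : Client W R G} {d : C}
    (hd : (σ'.client p).phase.toPropose = some d) :
    (σ.client p).phase.toPropose = some d ∨ a = .invoke p (.reconfig d) := by
  classical
  cases h
  case invoke q op hp hop =>
    rw [State.goto_client, Function.update_apply] at hd
    split_ifs at hd with hq
    · subst hq
      cases op <;> simp_all [Phase.toPropose, ReadCont.toPropose]
    · exact .inl hd
  all_goals
    left
    try simp only [State.goto_client, State.gotoWith_client, State.broadcast_client,
      State.reply_client, State.consume_client, State.setNext_client, State.addProposal_client,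
      State.setDecision_client, Function.update_apply] at hd
    first
    | exact hd
    | (split_ifs at hd with hq
       · subst hq
         simp_all [Phase.toPropose, PutCont.toPropose, ReadCont.toPropose]
       · exact hd)

end Proposals

namespace Execution

variable {S C V W R G : Type*} [LinearOrder W] {A : System S C V} {ξ : Execution W R G A}

/-- What is known about proposals after `n` steps: whoever is going to propose `d`, or has proposed
it, has invoked a reconfiguration with `d`; at most one client is going to propose `d`, none if `d`
was already proposed; `d` is proposed to at most one consensus instance; and decided values have
been proposed. -/
structure ProposalInv (ξ : Execution W R G A) (n : ℕ) : Prop where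
  invoked : ∀ p d, ((ξ.state n).client p).phase.toPropose = some d →
    ∃ a < n, ξ.act a = .invoke p (.reconfig d)
  unique : ∀ p q d, ((ξ.state n).client p).phase.toPropose = some d →
    ((ξ.state n).client q).phase.toPropose = some d → p = q
  proposed : ∀ c d, d ∈ (ξ.state n).proposed c →
    (∃ a < n, ∃ p, ξ.act a = .invoke p (.reconfig d)) ∧
      ∀ p, ((ξ.state n).client p).phase.toPropose ≠ some d
  inj : ∀ c c' d, d ∈ (ξ.state n).proposed c → d ∈ (ξ.state n).proposed c' → c = c'
  decided : ∀ c d, (ξ.state n).decided c = some d → d ∈ (ξ.state n).proposed c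

theorem proposalInv (hξ : ξ.DistinctReconfigs) (n : ℕ) : ξ.ProposalInv n := by
  induction n with
  | zero => constructor <;> simp [ξ.init, initState, Phase.toPropose]
  | succ n ih =>
    have hs := ξ.step n
    classical
    have hinv : ∀ p d, ((ξ.state (n + 1)).client p).phase.toPropose = some d →
        ∃ a < n + 1, ξ.act a = .invoke p (.reconfig d) := by
      intro p d h
      rcases hs.toPropose h with h | h
      · obtain ⟨a, ha, h⟩ := ih.invoked p d h
        exact ⟨a, by omega, h⟩
      · exact ⟨n, by omega, h⟩
    have hprop : (∀ c, (ξ.state (n + 1)).proposed c = (ξ.state n).proposed c) ∨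
        ∃ p c e, ((ξ.state n).client p).phase = .propose c ∧
          (∀ p', ((ξ.state (n + 1)).client p').phase.toPropose = some c → p' ≠ p) ∧
          (∀ d, ξ.act n ≠ .invoke p (.reconfig d)) ∧ (∀ q d, ξ.act n ≠ .invoke q d) ∧
          ∀ c' d, d ∈ (ξ.state (n + 1)).proposed c' →
            d ∈ (ξ.state n).proposed c' ∨ c' = e ∧ d = c := by
      clear hinv
      generalize ξ.act n = a at hs
      generalize ξ.state (n + 1) = σ' at hs
      cases hs
      case propose p c e hp he =>
        right
        refine ⟨p, c, e.1, hp, ?_, by simp, by simp, ?_⟩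
        · rintro p' h rfl
          simp [State.goto_client, Phase.toPropose] at h
        · intro c' d h
          change d ∈ Function.update (ξ.state n).proposed e.1
            (insert c ((ξ.state n).proposed e.1)) c' at h
          rw [Function.update_apply] at h
          split_ifs at h with hc
          · subst hc
            rcases h with h | h
            · exact .inr ⟨rfl, h⟩
            · exact .inl h
          · exact .inl h
      all_goals exact .inl fun _ => rfl
    have hdec : ∀ c d, (ξ.state (n + 1)).decided c = some d →
        (ξ.state n).decided c = some d ∨ d ∈ (ξ.state n).proposed c := by
      clear hinv hprop
      generalize ξ.act n = a at hs
      generalize ξ.state (n + 1) = σ' at hs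
      intro c d h
      cases hs
      case decide p c' e d' hp he hv hag =>
        change Function.update (ξ.state n).decided e.1 (some d') c = some d at h
        rw [Function.update_apply] at h
        split_ifs at h with hc
        · subst hc
          cases h
          exact .inr hv
        · exact .inl h
      all_goals exact .inl h
    refine ⟨hinv, ?_, ?_, ?_, ?_⟩
    · intro p q d hp hq
      obtain ⟨a, -, ha⟩ := hinv p d hp
      obtain ⟨b, -, hb⟩ := hinv q d hq
      obtain rfl := hξ.1 a b p q d ha hb
      rw [ha] at hb
      cases hb
      rfl
    · intro c d hd
      have old : d ∈ (ξ.state n).proposed c →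
          (∃ a < n + 1, ∃ p, ξ.act a = .invoke p (.reconfig d)) ∧
            ∀ p, ((ξ.state (n + 1)).client p).phase.toPropose ≠ some d := by
        intro hd
        obtain ⟨⟨a, ha, p, hp⟩, hno⟩ := ih.proposed c d hd
        refine ⟨⟨a, by omega, p, hp⟩, fun q hq => ?_⟩
        rcases hs.toPropose hq with h | h
        · exact hno q h
        · have := hξ.1 _ _ _ _ _ hp h
          omega
      rcases hprop with h | ⟨p, c₀, e, hp, hself, -, hinvk, h⟩
      · exact old (h c ▸ hd)
      · rcases h c d hd with h | ⟨rfl, rfl⟩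
        · exact old h
        · have hp' : ((ξ.state n).client p).phase.toPropose = some d := by
            rw [hp]; rfl
          obtain ⟨a, ha, h⟩ := ih.invoked p d hp'
          refine ⟨⟨a, by omega, p, h⟩, fun q hq => ?_⟩
          rcases hs.toPropose hq with h' | h'
          · exact hself q hq (ih.unique q p d h' hp')
          · exact hinvk _ _ h'
    · intro c c' d hc hc'
      rcases hprop with h | ⟨p, c₀, e, hp, -, -, -, h⟩
      · exact ih.inj c c' d (h c ▸ hc) (h c' ▸ hc')
      · have hp' : ((ξ.state n).client p).phase.toPropose = some c₀ := by
          rw [hp]; rfl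
        rcases h c d hc with h1 | ⟨rfl, rfl⟩ <;> rcases h c' d hc' with h2 | ⟨rfl, h3⟩
        · exact ih.inj c c' d h1 h2
        · subst h3
          exact absurd hp' ((ih.proposed _ _ h1).2 p)
        · exact absurd hp' ((ih.proposed _ _ h2).2 p)
        · rfl
    · intro c d hd
      rcases hdec c d hd with h | h
      · exact hs.proposed_mono (ih.decided c d h)
      · exact hs.proposed_mono h

/-- `d` is decided at some time by the consensus instance of `c`. -/
def Decides (ξ : Execution W R G A) (c d : C) : Prop := ∃ n, (ξ.state n).decided c = some d

theorem Decides.unique {c d d' : C} (h : ξ.Decides c d) (h' : ξ.Decides c d') : d = d' := by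
  obtain ⟨n, h⟩ := h
  obtain ⟨m, h'⟩ := h'
  have h1 := decided_mono (le_max_left n m) h
  rw [decided_mono (le_max_right n m) h'] at h1
  exact (Option.some.inj h1).symm

theorem Decides.inj (hξ : ξ.DistinctReconfigs) {c c' d : C} (h : ξ.Decides c d)
    (h' : ξ.Decides c' d) : c = c' := by
  obtain ⟨n, h⟩ := h
  obtain ⟨m, h'⟩ := h'
  have hinv := proposalInv hξ (max n m)
  exact hinv.inj c c' d (hinv.decided _ _ (decided_mono (le_max_left n m) h))
    (hinv.decided _ _ (decided_mono (le_max_right n m) h'))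

theorem Decides.ne_c0 (hξ : ξ.DistinctReconfigs) {c d : C} (h : ξ.Decides c d) : d ≠ A.c0 := by
  rintro rfl
  obtain ⟨n, h⟩ := h
  have hinv := proposalInv hξ n
  obtain ⟨⟨a, -, p, ha⟩, -⟩ := hinv.proposed _ _ (hinv.decided _ _ h)
  exact hξ.2 a p ha

/-- `ξ.At k c`: the configuration `c` has position `k` in the chain that starts with `c₀` and in
which each configuration is followed by the decision of its consensus instance. -/
inductive At (ξ : Execution W R G A) : ℕ → C → Prop
  | zero : At ξ 0 A.c0
  | succ {k : ℕ} {c d : C} : At ξ k c → ξ.Decides c d → At ξ (k + 1) d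

theorem At.unique {k : ℕ} {c d : C} (h : ξ.At k c) (h' : ξ.At k d) : c = d := by
  induction h generalizing d with
  | zero => cases h'; rfl
  | succ h hd ih =>
    cases h' with
    | succ h' hd' => exact hd.unique (ih h' ▸ hd')

/-- A configuration occurs at most once in the chain. -/
theorem At.inj (hξ : ξ.DistinctReconfigs) {k j : ℕ} {c : C} (h : ξ.At k c) (h' : ξ.At j c) :
    k = j := by
  induction h generalizing j with
  | zero =>
    generalize hc : A.c0 = c at h'
    cases h' with
    | zero => rfl
    | succ _ hd => exact absurd hc.symm (hd.ne_c0 hξ)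
  | succ h hd ih =>
    cases h' with
    | zero => exact absurd rfl (hd.ne_c0 hξ)
    | succ h' hd' => rw [ih (hd'.inj hξ hd ▸ h')]

end Execution

/-! ### Requests and replies -/

section Requests

variable {S C V W R G : Type*}

/-- The configuration whose servers the client is currently waiting for. -/
def Local.target (L : Local S C V W) : Option C :=
  match L.phase with
  | .readNextWait _ i _ => L.cseq[i]?.map Prod.fst
  | .putConfigWait _ i _ => L.cseq[i]?.map Prod.fst
  | _ => none

/-- A message with request number `r` that concerns configuration `c` is consistent with the state
of the client: it does not come from the future, and if it belongs to the current request, it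
concerns the configuration that the client is waiting for. -/
def Local.Addressed (L : Local S C V W) (r : ℕ) (c : C) : Prop :=
  r ≤ L.rid ∧ (r = L.rid → ∀ c', L.target = some c' → c' = c)

variable [LinearOrder W] {A : System S C V} {σ σ' : State S C V W R G} {a : Act C V W R G}

theorem Step.target (h : Step A σ a σ') (p : Client W R G) :
    ((σ'.client p).rid = (σ.client p).rid ∧
      ∀ c, (σ'.client p).target = some c → (σ.client p).target = some c) ∨
    (σ.client p).rid < (σ'.client p).rid := by
  classical
  cases h <;>
    simp only [State.goto_client, State.gotoWith_client, State.broadcast_client,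
      State.reply_client, State.consume_client, State.setNext_client, State.addProposal_client,
      State.setDecision_client, Function.update_apply] <;>
    first
    | exact .inl ⟨trivial, fun _ h => h⟩
    | (split_ifs with hq
       · subst hq
         simp_all [Local.target]
       · exact .inl ⟨rfl, fun _ h => h⟩)

theorem Step.addressed (h : Step A σ a σ') {p : Client W R G} {r : ℕ} {c : C}
    (hr : (σ.client p).Addressed r c) : (σ'.client p).Addressed r c := by
  rcases h.target p with ⟨h1, h2⟩ | h1
  · exact ⟨h1 ▸ hr.1, fun hr' c' hc' => hr.2 (h1 ▸ hr') c' (h2 c' hc')⟩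
  · exact ⟨hr.1.trans h1.le, fun hr' => absurd hr.1 (by omega)⟩

/-- A step puts into the channels only new requests to the servers of the current target, which in
`put-config` carry the next entry of the sender's sequence, answers to `read-next-config` with the
server's variable, and acknowledgements of a server whose variable is set. -/
theorem Step.net (h : Step A σ a σ') {m : Msg S C W R G} (hm : m ∈ σ'.net) :
    m ∈ σ.net ∨
    (∃ p s c, m = .readConfig p (σ'.client p).rid s c ∧ (σ'.client p).target = some c) ∨
    (∃ p s c e, m = .writeConfig p (σ'.client p).rid s c e ∧ (σ'.client p).target = some c ∧
      ∃ i f, (σ.client p).cseq[i]? = some f ∧ f.1 = c ∧ (σ.client p).cseq[i + 1]? = some e) ∨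
    (∃ p n s c, m = .nextConfig p n s c (σ.nextC s c) ∧ .readConfig p n s c ∈ σ.net) ∨
    (∃ p n s c e, m = .ack p n s c ∧ .writeConfig p n s c e ∈ σ.net ∧ σ'.nextC s c ≠ none) := by
  cases h
  case readNext p k i e hp he =>
    rcases hm with hm | ⟨s, hs, rfl⟩
    · exact .inl hm
    · refine .inr (.inl ⟨p, s, e.1, ?_, ?_⟩)
      · simp [State.broadcast_client]
      · simp [State.broadcast_client, Local.target, he]
  case putConfig p a i e e' hp he he' =>
    rcases hm with hm | ⟨s, hs, rfl⟩
    · exact .inl hm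
    · refine .inr (.inr (.inl ⟨p, s, e.1, e', ?_, ?_, i, e, he, rfl, he'⟩))
      · simp [State.broadcast_client]
      · simp [State.broadcast_client, Local.target, he]
  case readNextReply => exact .inl hm.1
  case putConfigAck => exact .inl hm.1
  case serverRead p n s c hm' =>
    rcases hm with hm | rfl
    · exact .inl hm.1
    · exact .inr (.inr (.inr (.inl ⟨p, n, s, c, rfl, hm'⟩)))
  case serverWrite p n s c e hm' hf =>
    rcases hm with hm | rfl
    · exact .inl hm.1
    · refine .inr (.inr (.inr (.inr ⟨p, n, s, c, e, rfl, hm', ?_⟩)))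
      simp [State.reply, State.setNext]
  case serverKeep p n s c e d hm' hf =>
    rcases hm with hm | rfl
    · exact .inl hm.1
    · refine .inr (.inr (.inr (.inr ⟨p, n, s, c, e, rfl, hm', ?_⟩)))
      simp [State.reply, hf]
  all_goals exact .inl hm

/-- A server takes the value of its variable from a `put-config` request. -/
theorem Step.nextC (h : Step A σ a σ') {s : S} {c : C} {e : Entry C}
    (he : σ'.nextC s c = some e) :
    σ.nextC s c = some e ∨ ∃ p n, .writeConfig p n s c e ∈ σ.net := by
  classical
  cases h
  case serverWrite p n s' c' e' hm hf =>
    change Function.update σ.nextC s' (Function.update (σ.nextC s') c' (some e')) s c = some e at he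
    rw [Function.update_apply] at he
    split_ifs at he with hs
    · subst hs
      rw [Function.update_apply] at he
      split_ifs at he with hc
      · subst hc
        cases he
        exact .inr ⟨p, n, hm⟩
      · exact .inl he
    · exact .inl he
  all_goals exact .inl he

end Requests

namespace Execution

variable {S C V W R G : Type*} [LinearOrder W] {A : System S C V} {ξ : Execution W R G A}

/-- The server `s` still had `nextC = ⊥` for `c` at some time when `p` had made at least `r`
requests. -/
def UnsetAfter (ξ : Execution W R G A) (p : Client W R G) (r : ℕ) (s : S) (c : C) : Prop :=
  ∃ m, r ≤ ((ξ.state m).client p).rid ∧ (ξ.state m).nextC s c = none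

/-- What is known after `n` steps about a message in transit. -/
def MsgInv (ξ : Execution W R G A) (n : ℕ) : Msg S C W R G → Prop
  | .readConfig p r _ c => ((ξ.state n).client p).Addressed r c
  | .nextConfig p r s c x => ((ξ.state n).client p).Addressed r c ∧ (x = none → ξ.UnsetAfter p r s c)
  | .writeConfig p r _ c _ => ((ξ.state n).client p).Addressed r c
  | .ack p r s c => ((ξ.state n).client p).Addressed r c ∧ (ξ.state n).nextC s c ≠ none

theorem msgInv (n : ℕ) : ∀ m ∈ (ξ.state n).net, ξ.MsgInv n m := by
  induction n with
  | zero => simp [ξ.init, initState]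
  | succ n ih =>
    intro m hm
    have hs := ξ.step n
    rcases hs.net hm with h | ⟨p, s, c, rfl, hc⟩ | ⟨p, s, c, e, rfl, hc, -⟩ | ⟨p, r, s, c, rfl, h⟩ |
        ⟨p, r, s, c, e, rfl, h, hne⟩
    · have h := ih m h
      cases m with
      | readConfig => exact hs.addressed h
      | nextConfig => exact ⟨hs.addressed h.1, h.2⟩
      | writeConfig => exact hs.addressed h
      | ack => exact ⟨hs.addressed h.1, hs.nextC_ne_none h.2⟩
    · exact ⟨le_rfl, fun _ c' h => by rw [hc] at h; exact (Option.some.inj h).symm⟩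
    · exact ⟨le_rfl, fun _ c' h => by rw [hc] at h; exact (Option.some.inj h).symm⟩
    · have h := ih _ h
      exact ⟨hs.addressed h, fun hnone => ⟨n, h.1, hnone⟩⟩
    · exact ⟨hs.addressed (ih _ h), hne⟩

end Execution

/-! ### Operations and the pairs they propagate -/

section Carried

variable {S C V W R G : Type*}

/-- The operation in progress and the pair that it propagates. -/
def ReadCont.carried : ReadCont C V W → Option (Op C V × Tag W × V)
  | .opening _ => none
  | .recheck op x _ => some (op, x)

/-- The operation in progress and the pair that it propagates, if a pair is already chosen. -/
def PutCont.carried : PutCont C V W → Option (Op C V × Tag W × V)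
  | .traverse k => k.carried
  | _ => none

/-- The operation in progress and the pair that it propagates, if a pair is already chosen. -/
def Phase.carried : Phase S C V W → Option (Op C V × Tag W × V)
  | .readConfig k => k.carried
  | .readNext k _ => k.carried
  | .readNextWait k _ _ => k.carried
  | .readDone k => k.carried
  | .putConfig a _ => a.carried
  | .putConfigWait a _ _ => a.carried
  | .putData op x => some (op, x)
  | .putDataWait op x => some (op, x)
  | _ => none

variable [LinearOrder W] {A : System S C V} {σ σ' : State S C V W R G} {a : Act C V W R G}

theorem Step.carried (h : Step A σ a σ') {p : Client W R G} {op : Op C V} {x : Tag W × V}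
    (hop : ∀ c, op ≠ .reconfig c) (hx : (σ.client p).phase.carried = some (op, x)) :
    (σ'.client p).phase.carried = some (op, x) ∨ ∃ r, (σ'.client p).phase = .returning r := by
  classical
  cases h <;>
    try simp only [State.goto_client, State.gotoWith_client, State.broadcast_client,
      State.reply_client, State.consume_client, State.setNext_client, State.addProposal_client,
      State.setDecision_client, Function.update_apply]
  all_goals
    first
    | exact .inl hx
    | (split_ifs with hq
       · subst hq
         simp_all [Phase.carried, ReadCont.carried, PutCont.carried, eq_comm]
       · exact .inl hx)

theorem Step.returning (h : Step A σ a σ') {p : Client W R G} {r : Option V}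
    (hp : (σ.client p).phase = .returning r) :
    (σ'.client p).phase = .returning r ∨ a = .respond p r := by
  classical
  cases h <;>
    try simp only [State.goto_client, State.gotoWith_client, State.broadcast_client,
      State.reply_client, State.consume_client, State.setNext_client, State.addProposal_client,
      State.setDecision_client, Function.update_apply]
  all_goals
    first
    | exact .inl hp
    | (split_ifs with hq
       · subst hq
         simp_all
       · exact .inl hp)

theorem Step.ne_idle (h : Step A σ a σ') {p : Client W R G} (hp : (σ.client p).phase ≠ .idle) :
    (σ'.client p).phase ≠ .idle ∨ ∃ r, a = .respond p r := by
  classical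
  cases h <;>
    try simp only [State.goto_client, State.gotoWith_client, State.broadcast_client,
      State.reply_client, State.consume_client, State.setNext_client, State.addProposal_client,
      State.setDecision_client, Function.update_apply]
  all_goals
    first
    | exact .inl hp
    | (split_ifs with hq
       · subst hq
         simp_all
       · exact .inl hp)

theorem Step.invoke_inv {p : Client W R G} {op : Op C V} (h : Step A σ (.invoke p op) σ') :
    (σ.client p).phase = .idle ∧ MayInvoke p op ∧
      (σ'.client p).phase = .readConfig (.opening op) := by
  cases h with
  | invoke _ _ hp hop => exact ⟨hp, hop, by simp [State.goto_client]⟩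

theorem Step.respond_inv {p : Client W R G} {r : Option V} (h : Step A σ (.respond p r) σ') :
    (σ.client p).phase = .returning r := by
  cases h with
  | respond _ _ hp => exact hp

theorem Step.putData_inv {p : Client W R G} {c : C} {t : Tag W} {v : V}
    (h : Step A σ (.dapInvoke p c (.putData t v)) σ') :
    ∃ op, (σ.client p).phase = .putData op (t, v) := by
  generalize ha : Act.dapInvoke p c (.putData t v) = a at h
  cases h <;> simp_all

end Carried

namespace Execution

variable {S C V W R G : Type*} [LinearOrder W] {A : System S C V} {ξ : Execution W R G A}

/-- The operation `op`, invoked by `p` in step `a`, is in progress after `n` steps. -/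
def Running (ξ : Execution W R G A) (n : ℕ) (p : Client W R G) (a : ℕ) (op : Op C V) : Prop :=
  a < n ∧ ξ.act a = .invoke p op ∧ ∀ k, a < k → k < n → ∀ r, ξ.act k ≠ .respond p r

theorem Running.succ {n : ℕ} {p : Client W R G} {a : ℕ} {op : Op C V} (h : ξ.Running n p a op)
    (hn : ∀ r, ξ.act n ≠ .respond p r) : ξ.Running (n + 1) p a op := by
  refine ⟨h.1.trans n.lt_succ_self, h.2.1, fun k hk hkn => ?_⟩
  rcases Nat.lt_succ_iff_lt_or_eq.mp hkn with hlt | rfl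
  · exact h.2.2 k hk hlt
  · exact hn

theorem Running.of_le {m n : ℕ} {p : Client W R G} {a : ℕ} {op : Op C V} (h : ξ.Running n p a op)
    (ha : a < m) (hmn : m ≤ n) : ξ.Running m p a op :=
  ⟨ha, h.2.1, fun k hk hkm => h.2.2 k hk (hkm.trans_le hmn)⟩

theorem Running.ne_idle {n : ℕ} {p : Client W R G} {a : ℕ} {op : Op C V}
    (h : ξ.Running n p a op) : ((ξ.state n).client p).phase ≠ .idle := by
  obtain ⟨han, ha, hno⟩ := h
  induction n, han using Nat.le_induction with
  | base =>
    have := (ha ▸ ξ.step a).invoke_inv.2.2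
    simp [this]
  | succ n hn ih =>
    rcases (ξ.step n).ne_idle (ih fun k hk hkn => hno k hk (by omega)) with h | ⟨r, h⟩
    · exact h
    · exact absurd h (hno n hn n.lt_succ_self r)

theorem Running.unique {n : ℕ} {p : Client W R G} {a b : ℕ} {op op' : Op C V}
    (h : ξ.Running n p a op) (h' : ξ.Running n p b op') : a = b ∧ op = op' := by
  have aux : ∀ {a b : ℕ} {op op' : Op C V}, ξ.Running n p a op → ξ.Running n p b op' → ¬ a < b :=
    fun h h' hab =>
      (h.of_le hab h'.1.le).ne_idle (h'.2.1 ▸ ξ.step _ : Step A _ (.invoke p _) _).invoke_inv.1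
  obtain rfl : a = b := by
    have := aux h h'
    have := aux h' h
    omega
  have h2 := h.2.1
  rw [h'.2.1] at h2
  simp only [Act.invoke.injEq, true_and] at h2
  exact ⟨rfl, h2.symm⟩

/-- Two invocations by the same client: the first operation is complete before the second. -/
theorem precedes_of_lt {p : Client W R G} {a b : ℕ} {op op' : Op C V} (ha : ξ.act a = .invoke p op)
    (hb : ξ.act b = .invoke p op') (hab : a < b) : ξ.Precedes a b := by
  classical
  have hex : ∃ k, a < k ∧ k < b ∧ ∃ r, ξ.act k = .respond p r := by
    by_contra hno
    refine Running.ne_idle (ξ := ξ) (n := b) (p := p) (a := a) (op := op)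
      ⟨hab, ha, fun k hk hkb r hr => hno ⟨k, hk, hkb, r, hr⟩⟩ ?_
    exact (hb ▸ ξ.step b : Step A _ (.invoke p op') _).invoke_inv.1
  obtain ⟨h1, h2, r, hr⟩ := Nat.find_spec hex
  exact ⟨op, r, Nat.find hex, ⟨p, ha, h1, hr, fun k hk hkj r' hr' =>
    Nat.find_min hex hkj ⟨hk, hkj.trans h2, r', hr'⟩⟩, h2⟩

/-- The read or write invoked in step `a` propagates the pair `x`. -/
def HasPair (ξ : Execution W R G A) (a : ℕ) (x : Tag W × V) : Prop :=
  ∃ p op m, ξ.Running m p a op ∧ (∀ c, op ≠ .reconfig c) ∧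
    ((ξ.state m).client p).phase.carried = some (op, x)

/-- Once chosen, the pair of a read or write is kept until the operation returns. -/
theorem carried_of_running {m n : ℕ} {p : Client W R G} {a : ℕ} {op : Op C V} {x : Tag W × V}
    (hop : ∀ c, op ≠ .reconfig c) (hx : ((ξ.state m).client p).phase.carried = some (op, x))
    (ham : a < m) (hmn : m ≤ n) (hn : ξ.Running n p a op) :
    ((ξ.state n).client p).phase.carried = some (op, x) ∨
      ∃ r, ((ξ.state n).client p).phase = .returning r := by
  induction n, hmn using Nat.le_induction with
  | base => exact .inl hx
  | succ n hmn ih =>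
    rcases ih (hn.of_le (by omega) n.le_succ) with h | ⟨r, h⟩
    · exact (ξ.step n).carried hop h
    · rcases (ξ.step n).returning h with h | h
      · exact .inr ⟨r, h⟩
      · exact absurd h (hn.2.2 n (by omega) n.lt_succ_self r)

theorem HasPair.unique {a : ℕ} {x y : Tag W × V} (hx : ξ.HasPair a x) (hy : ξ.HasPair a y) :
    x = y := by
  obtain ⟨p, op, m, hm, hop, hx⟩ := hx
  obtain ⟨q, op', m', hm', -, hy⟩ := hy
  have h := hm.2.1
  rw [hm'.2.1] at h
  obtain ⟨rfl, rfl⟩ := Act.invoke.inj h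
  have aux : ∀ {m m' : ℕ} {x y : Tag W × V}, m ≤ m' → ξ.Running m q a op' →
      ξ.Running m' q a op' → ((ξ.state m).client q).phase.carried = some (op', x) →
      ((ξ.state m').client q).phase.carried = some (op', y) → x = y := by
    intro m m' x y hmm hm hm' hx hy
    rcases carried_of_running hop hx hm.1 hmm hm' with h | ⟨r, h⟩
    · rw [hy] at h
      simpa using h.symm
    · rw [h] at hy
      simp [Phase.carried] at hy
  rcases le_total m m' with h | h
  · exact aux h hm hm' hx hy
  · exact (aux h hm' hm hy hx).symm

/-- The pair `x` is the initial pair or the pair of some write. -/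
def Sourced (ξ : Execution W R G A) (x : Tag W × V) : Prop :=
  x = (tag0 W, A.v0) ∨ ∃ b v, ξ.IsWrite b v ∧ ξ.HasPair b x

/-! ### Finalized configurations dominate earlier tags -/

/-- After `n` steps, all servers of a quorum of `c` know the successor of `c`. -/
def QuorumSet (ξ : Execution W R G A) (n : ℕ) (c : C) : Prop :=
  ∃ Q ∈ A.quorums c, ∀ s ∈ Q, (ξ.state n).nextC s c ≠ none

/-- Each server of some quorum of `c` did not know the successor of `c` at some time after
step `b`. -/
def QuorumUnset (ξ : Execution W R G A) (b : ℕ) (c : C) : Prop :=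
  ∃ Q ∈ A.quorums c, ∀ s ∈ Q, ∃ m, b < m ∧ (ξ.state m).nextC s c = none

theorem QuorumSet.mono {m n : ℕ} {c : C} (h : ξ.QuorumSet m c) (hmn : m ≤ n) :
    ξ.QuorumSet n c := by
  obtain ⟨Q, hQ, h⟩ := h
  exact ⟨Q, hQ, fun s hs => nextC_ne_none_mono hmn (h s hs)⟩

/-- Quorum intersection: a variable that is set stays set, so the common server answered `⊥` before
the quorum was set. -/
theorem QuorumSet.gt_of_unset {n b : ℕ} {c : C} (h : ξ.QuorumSet n c) (h' : ξ.QuorumUnset b c) :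
    b + 1 < n := by
  obtain ⟨Q, hQ, h⟩ := h
  obtain ⟨Q', hQ', h'⟩ := h'
  obtain ⟨s, hs, hs'⟩ := A.quorum_inter c Q hQ Q' hQ'
  obtain ⟨m, hbm, hm⟩ := h' s hs'
  by_contra hlt
  exact nextC_ne_none_mono (by omega) (h s hs) hm

/-- A `get-tag` or `get-data` of `c`, invoked in step `m` or later, returned a tag `≤ t`. -/
def Got (ξ : Execution W R G A) (m : ℕ) (c : C) (t : Tag W) : Prop :=
  ∃ q i j t', m ≤ i ∧ t' ≤ t ∧ (ξ.CompleteDap c q .getTag (.tag t') i j ∨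
    ∃ v, ξ.CompleteDap c q .getData (.pair t' v) i j)

/-- A `put-data` of `c` with a tag `≥ t` was complete before step `n`. -/
def Put (ξ : Execution W R G A) (n : ℕ) (c : C) (t : Tag W) : Prop :=
  ∃ q t' v i j, ξ.CompleteDap c q (.putData t' v) .ack i j ∧ j < n ∧ t ≤ t'

theorem Got.mono {m : ℕ} {c : C} {t t' : Tag W} (h : ξ.Got m c t) (ht : t ≤ t') :
    ξ.Got m c t' := by
  obtain ⟨q, i, j, t₁, hi, h1, h⟩ := h
  exact ⟨q, i, j, t₁, hi, h1.trans ht, h⟩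

theorem Put.mono {m n : ℕ} {c : C} {t t' : Tag W} (h : ξ.Put m c t) (hmn : m ≤ n) (ht : t' ≤ t) :
    ξ.Put n c t' := by
  obtain ⟨q, t₁, v, i, j, h, hj, h1⟩ := h
  exact ⟨q, t₁, v, i, j, h, hj.trans_le hmn, ht.trans h1⟩

theorem Put.le_of_got {m : ℕ} {c : C} {t t' : Tag W} (h : ξ.Put m c t) (hC1 : ξ.C1 c)
    (h' : ξ.Got m c t') : t ≤ t' := by
  obtain ⟨p, t₁, v, i, j, h, hj, h1⟩ := h
  obtain ⟨q, i', j', t₂, hi, h2, h'⟩ := h'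
  have key := hC1 p q t₁ v i j i' j' h (hj.trans_le hi)
  rcases h' with h' | ⟨v', h'⟩
  · exact h1.trans ((key.1 _ h').trans h2)
  · exact h1.trans ((key.2 _ _ h').trans h2)

/-- `ξ.Finalized n c`: the evidence on which `c` may be marked as finalized after `n` steps. Either
`c` is initial, or `c` is the last configuration of a sequence `l` such that at a time `m` all earlier
configurations of `l` had a quorum that knew the successor, the configuration at some earlier index
`μ` was finalized, and the configurations from `μ` on have afterwards returned tags of at most `t`,
where a tag of at least `t` has been put into `c`. -/
inductive Finalized (ξ : Execution W R G A) : ℕ → C → Prop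
  | init (n : ℕ) : Finalized ξ n A.c0
  | step {m n : ℕ} {l : List (Entry C)} {μ : ℕ} {e f : Entry C} {t : Tag W}
      (seq : ∀ j g, l[j]? = some g → ξ.At j g.1)
      (set : ∀ j c, j + 1 < l.length → ξ.At j c → ξ.QuorumSet m c)
      (hμ : l[μ]? = some e) (fin : Finalized ξ m e.1) (last : l.getLast? = some f)
      (lt : μ + 1 < l.length) (got : ∀ j g, μ ≤ j → l[j]? = some g → ξ.Got m g.1 t)
      (put : ξ.Put n f.1 t) : Finalized ξ n f.1

theorem Finalized.mono {m n : ℕ} {c : C} (h : ξ.Finalized m c) (hmn : m ≤ n) :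
    ξ.Finalized n c := by
  cases h with
  | init => exact .init n
  | step seq set hμ fin last lt got put =>
    exact .step seq set hμ fin last lt got (put.mono hmn le_rfl)

/-- If a tag `≥ t` had been put into the configuration `c` at position `k` before any quorum of `c`
knew the successor of `c`, then a tag `≥ t` has been put into every finalized configuration at a
later position.  This is where the sequences of configurations known to different clients come
together: the reconfiguration that finalized the later configuration either queried `c` itself, or
started from a configuration beyond `c` that was finalized before. -/
theorem Finalized.put (hξ : ξ.DistinctReconfigs) (hC1 : ∀ c, ξ.C1 c) {k : ℕ} {c : C} {t : Tag W}
    (hc : ξ.At k c) (hset : ∀ n, ξ.QuorumSet n c → ξ.Put n c t) {n j : ℕ} {d : C}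
    (hfin : ξ.Finalized n d) (hd : ξ.At j d) (hkj : k < j) : ξ.Put n d t := by
  induction hfin generalizing j with
  | init => have := hd.inj hξ .zero; omega
  | @step m n l μ e f t' seq set hμ fin last lt got put ih =>
    rw [List.getLast?_eq_getElem?] at last
    obtain rfl := hd.inj hξ (seq _ _ last)
    obtain ⟨g, hg⟩ : ∃ g, l[k]? = some g := ⟨_, List.getElem?_eq_getElem (by omega)⟩
    have hgc : g.1 = c := (seq _ _ hg).unique hc
    refine put.mono le_rfl ?_
    rcases le_or_gt μ k with hμk | hμk
    · exact (hset m (set k c (by omega) hc)).le_of_got (hC1 c) (hgc ▸ got k g hμk hg)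
    · exact (ih (seq μ e hμ) hμk).le_of_got (hC1 _) (got μ e le_rfl hμ)

/-- A client whose configuration sequence is `l` since time `m` has queried its configurations
from index `μ` up to `i`, exclusively, obtaining in each of them at most a tag in `T`. -/
structure Query (ξ : Execution W R G A) (m : ℕ) (l : List (Entry C)) (μ i : ℕ)
    (T : Set (Tag W)) : Prop where
  seq : ∀ j g, l[j]? = some g → ξ.At j g.1
  set : ∀ j c, j + 1 < l.length → ξ.At j c → ξ.QuorumSet m c
  fin : ∃ e, l[μ]? = some e ∧ ξ.Finalized m e.1
  got : ∀ j g, μ ≤ j → j < i → l[j]? = some g → ∃ t ∈ T, ξ.Got m g.1 t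

/-- A query that covers the rest of the sequence finds any tag that had been put, into a
configuration of the sequence, before the query and before a quorum of that configuration knew the
successor. -/
theorem Query.exists_le (hξ : ξ.DistinctReconfigs) (hC1 : ∀ c, ξ.C1 c) {k : ℕ} {c : C} {t : Tag W}
    (hc : ξ.At k c) (hset : ∀ n, ξ.QuorumSet n c → ξ.Put n c t) {m : ℕ} {l : List (Entry C)}
    {μ : ℕ} {T : Set (Tag W)} (h : ξ.Query m l μ l.length T) (hput : ξ.Put m c t)
    (hk : k < l.length) : ∃ t' ∈ T, t ≤ t' := by
  obtain ⟨e, hμ, hfin⟩ := h.fin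
  have hμl : μ < l.length := (List.getElem?_eq_some_iff.mp hμ).1
  rcases le_or_gt μ k with hμk | hμk
  · obtain ⟨g, hg⟩ : ∃ g, l[k]? = some g := ⟨_, List.getElem?_eq_getElem hk⟩
    have hgc : g.1 = c := (h.seq _ _ hg).unique hc
    obtain ⟨t', ht', hgot⟩ := h.got k g hμk hk hg
    exact ⟨t', ht', hput.le_of_got (hC1 c) (hgc ▸ hgot)⟩
  · obtain ⟨t', ht', hgot⟩ := h.got μ e le_rfl hμl hμ
    exact ⟨t', ht', (hfin.put hξ hC1 hc hset (h.seq _ _ hμ) hμk).le_of_got (hC1 _) hgot⟩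

end Execution

/-! ### The invariant of the executions -/

section Sequences

variable {C : Type*}

theorem assign_getElem? {l : List (Entry C)} {i : ℕ} {e : Entry C} (h : i ≤ l.length) (j : ℕ) :
    (assign l i e)[j]? = if j = i then some e else l[j]? := by
  unfold assign
  rcases lt_trichotomy j i with hj | rfl | hj
  · rw [List.getElem?_append_left (by simp; omega), List.getElem?_take_of_lt hj, if_neg hj.ne]
  · rw [List.getElem?_append_right (by simp)]
    simp [h]
  · rw [List.getElem?_append_right (by simp; omega), if_neg hj.ne', List.length_take_of_le h]
    obtain ⟨k, rfl⟩ := Nat.exists_eq_add_of_lt hj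
    rw [show i + k + 1 - i = k + 1 by omega, List.getElem?_cons_succ, List.getElem?_drop]
    congr 1
    omega

theorem length_assign {l : List (Entry C)} {i : ℕ} {e : Entry C} (h : i ≤ l.length) :
    (assign l i e).length = max l.length (i + 1) := by
  simp only [assign, List.length_append, List.length_take, List.length_cons, List.length_drop]
  omega

theorem lt_length_of_getElem? {l : List C} {i : ℕ} {e : C} (h : l[i]? = some e) :
    i < l.length := (List.getElem?_eq_some_iff.mp h).1

theorem getLast?_eq_some {l : List C} {e : C} (h : l.getLast? = some e) :
    0 < l.length ∧ l[l.length - 1]? = some e := by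
  rw [List.getLast?_eq_getElem?] at h
  have := lt_length_of_getElem? h
  exact ⟨by omega, h⟩

end Sequences

/-- The index of the configuration in which the client is executing `put-config`. -/
def Phase.writing {S C V W : Type*} : Phase S C V W → Option ℕ
  | .putConfig _ i => some i
  | .putConfigWait _ i _ => some i
  | _ => none

namespace Execution

variable {S C V W R G : Type*} [LinearOrder W] {A : System S C V} (ξ : Execution W R G A)

/-- An entry that is stored or sent as the successor of `c` names the decision for `c`, and is
marked as finalized only with evidence. -/
def EntryInv (n : ℕ) (c : C) (e : Entry C) : Prop :=
  ξ.Decides c e.1 ∧ (e.2 = .finalized → ξ.Finalized n e.1)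

/-- A configuration sequence is an initial segment of the chain, and its entries are marked as
finalized only with evidence. -/
def SeqInv (n : ℕ) (l : List (Entry C)) : Prop :=
  ∀ i e, l[i]? = some e → ξ.At i e.1 ∧ (e.2 = .finalized → ξ.Finalized n e.1)

/-- The last configuration of `l` had no known successor at some time after step `b`. -/
def Fresh (b : ℕ) (l : List (Entry C)) : Prop :=
  ∃ e, l.getLast? = some e ∧ ξ.QuorumUnset b e.1

/-- How the pair `x` of the read or write `op`, invoked by `p` in step `a`, came about: by a query
of all configurations from a finalized one up to one that was still the last of the chain after the
invocation. -/
def Started (p : Client W R G) (a : ℕ) (op : Op C V) (x : Tag W × V) : Prop :=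
  ∃ m l μ t, a < m ∧ ξ.Fresh a l ∧ ξ.Query m l μ l.length {t} ∧
    match op with
    | .read => x.1 = t ∧ ξ.Sourced x
    | .write v => x.2 = v ∧ ∃ w, p = .writer w ∧ x.1 = Tag.inc t w
    | .reconfig _ => False

/-- The continuation `k` of a `read-config` belongs to the operation `op` in progress, and the
`read-config` started after step `b`: the invocation of the operation or the response of the
preceding `put-data`. -/
def ReadInv (n : ℕ) (p : Client W R G) (l : List (Entry C)) (a : ℕ) (op : Op C V) (b : ℕ) :
    ReadCont C V W → Prop
  | .opening op' => op' = op ∧ b = a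
  | .recheck op' x ν => op' = op ∧ ξ.Started p a op x ∧ a < b ∧ b < n ∧ 0 < ν ∧ ν ≤ l.length ∧
      ∃ c i, ξ.At (ν - 1) c ∧ ξ.CompleteDap c p (.putData x.1 x.2) .ack i b

/-- A client is in the middle of a `read-config`. -/
def Reading (n : ℕ) (p : Client W R G) (l : List (Entry C)) (k : ReadCont C V W) : Prop :=
  ∃ a op b, ξ.Running n p a op ∧ ξ.ReadInv n p l a op b k

/-- A data access primitive of `c` that `p` invoked in step `m` or later is pending. -/
def Pending (m n : ℕ) (p : Client W R G) (c : C) (call : DapCall V W) : Prop :=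
  ∃ i, m ≤ i ∧ i < n ∧ ξ.act i = .dapInvoke p c call ∧
    ∀ k, i < k → k < n → ∀ ret, ξ.act k ≠ .dapRespond p c ret

/-- The state of the query of a write. -/
def TagQuery (n : ℕ) (p : Client W R G) (l : List (Entry C)) (v : V) (i : ℕ) (t : Tag W) (m : ℕ) :
    Prop :=
  ∃ a μ, ξ.Running n p a (.write v) ∧ a < m ∧ m ≤ n ∧ ξ.Fresh a l ∧ ξ.Query m l μ i {t}

/-- The state of the query of a read or reconfiguration. -/
def DataQuery (n : ℕ) (p : Client W R G) (l : List (Entry C)) (op : Op C V) (i : ℕ)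
    (M : Set (Tag W × V)) (m : ℕ) : Prop :=
  ∃ a μ, ξ.Running n p a op ∧ a < m ∧ m ≤ n ∧ ξ.Query m l μ i (Prod.fst '' M) ∧
    (∀ x ∈ M, ξ.Sourced x) ∧ match op with
    | .read => ξ.Fresh a l
    | .write _ => False
    | .reconfig _ => μ + 1 < l.length

/-- A client is about to put the pair `x`, or is doing so. -/
def PutInv (n : ℕ) (p : Client W R G) (l : List (Entry C)) (op : Op C V) (x : Tag W × V) : Prop :=
  ∃ a, ξ.Running n p a op ∧ (ξ.Started p a op x ∨
    (∃ c, op = .reconfig c) ∧ ξ.Sourced x ∧ ∃ m μ, ξ.Query m l μ l.length {x.1} ∧ μ + 1 < l.length)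

/-- The read or write invoked in step `a` has put its pair `x` into a configuration that afterwards
was still the last of the chain. -/
def Finished (n : ℕ) (p : Client W R G) (a : ℕ) (op : Op C V) (x : Tag W × V) : Prop :=
  ξ.HasPair a x ∧ ξ.Started p a op x ∧ ∃ k c i b, ξ.At k c ∧
    ξ.CompleteDap c p (.putData x.1 x.2) .ack i b ∧ a < b ∧ b < n ∧ ξ.QuorumUnset b c ∧
      ∀ j d, j < k → ξ.At j d → ξ.QuorumSet n d

/-- What is known after `n` steps about a client with configuration sequence `l`, according to its
program counter. -/
def PhaseInv (n : ℕ) (p : Client W R G) (l : List (Entry C)) (r : ℕ) : Phase S C V W → Prop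
  | .idle => True
  | .readConfig k => ξ.Reading n p l k
  | .readNext k _ => ξ.Reading n p l k
  | .readNextWait k _ _ => ∃ a op b m, ξ.Running n p a op ∧ ξ.ReadInv n p l a op b k ∧ b ≤ m ∧
      ((ξ.state m).client p).rid < r ∧ ∀ i c, i + 1 < l.length → ξ.At i c → ξ.QuorumSet m c
  | .readDone k => ∃ a op b, ξ.Running n p a op ∧ ξ.ReadInv n p l a op b k ∧ ξ.Fresh b l
  | .putConfig (.traverse k) _ => ξ.Reading n p l k
  | .putConfigWait (.traverse k) _ _ => ξ.Reading n p l k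
  | .putConfig (.added c) i => (∃ a, ξ.Running n p a (.reconfig c)) ∧ l.length = i + 2 ∧
      ∃ d, l[i + 1]? = some (d, .pending)
  | .putConfigWait (.added c) i _ => (∃ a, ξ.Running n p a (.reconfig c)) ∧ l.length = i + 2 ∧
      ∃ d, l[i + 1]? = some (d, .pending)
  | .putConfig .finalizing _ => ∃ a c, ξ.Running n p a (.reconfig c)
  | .putConfigWait .finalizing _ _ => ∃ a c, ξ.Running n p a (.reconfig c)
  | .getTag v i t => ∃ m, ξ.TagQuery n p l v i t m
  | .getTagWait v i t => ∃ m, ξ.TagQuery n p l v i t m ∧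
      ∀ e, l[i]? = some e → ξ.Pending m n p e.1 .getTag
  | .getData op i M => ∃ m, ξ.DataQuery n p l op i M m
  | .getDataWait op i M => ∃ m, ξ.DataQuery n p l op i M m ∧
      ∀ e, l[i]? = some e → ξ.Pending m n p e.1 .getData
  | .putData op x => ξ.PutInv n p l op x
  | .putDataWait op x => ξ.PutInv n p l op x ∧
      ∀ e, l.getLast? = some e → ξ.Pending 0 n p e.1 (.putData x.1 x.2)
  | .propose c => ∃ a, ξ.Running n p a (.reconfig c)
  | .proposeWait c => ∃ a, ξ.Running n p a (.reconfig c)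
  | .finalize => (∃ a c, ξ.Running n p a (.reconfig c)) ∧
      ∀ e, l.getLast? = some e → ξ.Finalized n e.1
  | .returning r => ∃ a op, ξ.Running n p a op ∧
      ((∃ c, op = .reconfig c) ∨ ∃ x, r = op.result x ∧ ξ.Finished n p a op x)

/-- What is known after `n` steps about a client. -/
structure ClientInv (n : ℕ) (p : Client W R G) (L : Local S C V W) : Prop where
  seq : ξ.SeqInv n L.cseq
  set : ∀ i c, i + 1 < L.cseq.length → L.phase.writing ≠ some i → ξ.At i c → ξ.QuorumSet n c
  ack : ∀ a i B e, L.phase = .putConfigWait a i B → L.cseq[i]? = some e →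
    ∀ s ∈ B, (ξ.state n).nextC s e.1 ≠ none
  ans : ∀ k i ρ e, L.phase = .readNextWait k i ρ → L.cseq[i]? = some e →
    ∀ s x, (s, x) ∈ ρ → (∀ f, x = some f → ξ.EntryInv n e.1 f) ∧
      (x = none → ξ.UnsetAfter p L.rid s e.1)
  phase : ξ.PhaseInv n p L.cseq L.rid L.phase

/-- What is known after `n` steps about the entry carried by a message. -/
def MsgEntry (n : ℕ) : Msg S C W R G → Prop
  | .nextConfig _ _ _ c (some e) => ξ.EntryInv n c e
  | .writeConfig _ _ _ c e => ξ.EntryInv n c e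
  | _ => True

/-- The inductive invariant. -/
structure Inv (n : ℕ) : Prop where
  client : ∀ p, ξ.ClientInv n p ((ξ.state n).client p)
  msg : ∀ m ∈ (ξ.state n).net, ξ.MsgEntry n m
  server : ∀ s c e, (ξ.state n).nextC s c = some e → ξ.EntryInv n c e
  puts : ∀ i < n, ∀ q c t v, ξ.act i = .dapInvoke q c (.putData t v) → ξ.Sourced (t, v)

variable {ξ} {n : ℕ} {p : Client W R G}

theorem EntryInv.mono {m : ℕ} (hmn : m ≤ n) {c : C} {e : Entry C} (h : ξ.EntryInv m c e) :
    ξ.EntryInv n c e := ⟨h.1, fun hf => (h.2 hf).mono hmn⟩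

theorem SeqInv.mono {m : ℕ} (hmn : m ≤ n) {l : List (Entry C)} (h : ξ.SeqInv m l) :
    ξ.SeqInv n l := fun i e hi => ⟨(h i e hi).1, fun hf => ((h i e hi).2 hf).mono hmn⟩

theorem SeqInv.decides {l : List (Entry C)} (h : ξ.SeqInv n l) {i : ℕ} {e f : Entry C}
    (he : l[i]? = some e) (hf : l[i + 1]? = some f) : ξ.EntryInv n e.1 f := by
  refine ⟨?_, (h _ _ hf).2⟩
  have h1 := (h _ _ he).1
  have h2 := (h _ _ hf).1
  generalize f.1 = d at h2
  cases h2 with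
  | succ hc hd => exact hc.unique h1 ▸ hd

theorem SeqInv.assign {l : List (Entry C)} (h : ξ.SeqInv n l) {i : ℕ} {e f : Entry C}
    (he : l[i]? = some e) (hf : ξ.EntryInv n e.1 f) : ξ.SeqInv n (assign l (i + 1) f) := by
  intro j g hg
  rw [assign_getElem? (lt_length_of_getElem? he)] at hg
  split_ifs at hg with hj
  · cases hg
    subst hj
    exact ⟨.succ (h _ _ he).1 hf.1, hf.2⟩
  · exact h j g hg

theorem ReadInv.succ {l : List (Entry C)} {a : ℕ} {op : Op C V} {b : ℕ} {k : ReadCont C V W}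
    (h : ξ.ReadInv n p l a op b k) : ξ.ReadInv (n + 1) p l a op b k := by
  cases k with
  | opening => exact h
  | recheck =>
    obtain ⟨h1, h2, h3, h4, h5⟩ := h
    exact ⟨h1, h2, h3, h4.trans n.lt_succ_self, h5⟩

theorem ReadInv.of_length_le {l l' : List (Entry C)} {a : ℕ} {op : Op C V} {b : ℕ}
    {k : ReadCont C V W} (h : ξ.ReadInv n p l a op b k) (hl : l.length ≤ l'.length) :
    ξ.ReadInv n p l' a op b k := by
  cases k with
  | opening => exact h
  | recheck =>
    obtain ⟨h1, h2, h3, h4, h5, h6, h7⟩ := h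
    exact ⟨h1, h2, h3, h4, h5, h6.trans hl, h7⟩

theorem ReadInv.lt {l : List (Entry C)} {a : ℕ} {op : Op C V} {b : ℕ} {k : ReadCont C V W}
    (h : ξ.ReadInv n p l a op b k) (hr : ξ.Running n p a op) : b < n := by
  cases k with
  | opening => exact h.2 ▸ hr.1
  | recheck => exact h.2.2.2.1

theorem Pending.succ {m : ℕ} {c : C} {call : DapCall V W} (h : ξ.Pending m n p c call)
    (hn : ∀ c ret, ξ.act n ≠ .dapRespond p c ret) : ξ.Pending m (n + 1) p c call := by
  obtain ⟨i, h1, h2, h3, h4⟩ := h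
  refine ⟨i, h1, by omega, h3, fun k hk hkn => ?_⟩
  rcases Nat.lt_succ_iff_lt_or_eq.mp hkn with hlt | rfl
  · exact h4 k hk hlt
  · exact hn c

theorem Pending.complete {m : ℕ} {c : C} {call : DapCall V W} {ret : DapRet V W}
    (h : ξ.Pending m n p c call) (hn : ξ.act n = .dapRespond p c ret) :
    ∃ i, m ≤ i ∧ ξ.CompleteDap c p call ret i n := by
  obtain ⟨i, h1, h2, h3, h4⟩ := h
  exact ⟨i, h1, h3, h2, hn, h4⟩

theorem Pending.of_invoke {m : ℕ} (hmn : m ≤ n) {c : C} {call : DapCall V W}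
    (hn : ξ.act n = .dapInvoke p c call) : ξ.Pending m (n + 1) p c call :=
  ⟨n, hmn, n.lt_succ_self, hn, fun k hk hkn => by omega⟩

theorem Finished.succ {a : ℕ} {op : Op C V} {x : Tag W × V} (h : ξ.Finished n p a op x) :
    ξ.Finished (n + 1) p a op x := by
  obtain ⟨h1, h2, k, c, i, b, h3, h4, h5, h6, h7, h8⟩ := h
  exact ⟨h1, h2, k, c, i, b, h3, h4, h5, by omega, h7,
    fun j d hj hd => (h8 j d hj hd).mono n.le_succ⟩

/-- The knowledge about a client persists in steps in which it neither returns from an operation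
nor gets the response of a data access primitive. -/
theorem PhaseInv.succ {l : List (Entry C)} {r : ℕ} {φ : Phase S C V W} (h : ξ.PhaseInv n p l r φ)
    (h1 : ∀ r, ξ.act n ≠ .respond p r) (h2 : ∀ c ret, ξ.act n ≠ .dapRespond p c ret) :
    ξ.PhaseInv (n + 1) p l r φ := by
  have hreading : ∀ {k}, ξ.Reading n p l k → ξ.Reading (n + 1) p l k := by
    rintro k ⟨a, op, b, h, h'⟩
    exact ⟨a, op, b, h.succ h1, h'.succ⟩
  have htag : ∀ {v i t m}, ξ.TagQuery n p l v i t m → ξ.TagQuery (n + 1) p l v i t m := by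
    rintro _ _ _ _ ⟨a, μ, h, ham, hmn, h'⟩
    exact ⟨a, μ, h.succ h1, ham, hmn.trans n.le_succ, h'⟩
  have hdata : ∀ {op i M m}, ξ.DataQuery n p l op i M m → ξ.DataQuery (n + 1) p l op i M m := by
    rintro _ _ _ _ ⟨a, μ, h, ham, hmn, h'⟩
    exact ⟨a, μ, h.succ h1, ham, hmn.trans n.le_succ, h'⟩
  have hput : ∀ {op x}, ξ.PutInv n p l op x → ξ.PutInv (n + 1) p l op x := by
    rintro op x ⟨a, h, h'⟩
    exact ⟨a, h.succ h1, h'⟩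
  have hrun : ∀ {c}, (∃ a, ξ.Running n p a (.reconfig c)) →
      ∃ a, ξ.Running (n + 1) p a (.reconfig c) := fun ⟨a, h⟩ => ⟨a, h.succ h1⟩
  have hrun' : (∃ a c, ξ.Running n p a (.reconfig c)) →
      ∃ a c, ξ.Running (n + 1) p a (.reconfig c) := fun ⟨a, c, h⟩ => ⟨a, c, h.succ h1⟩
  cases φ with
  | idle => trivial
  | readConfig k => exact hreading h
  | readNext k => exact hreading h
  | readNextWait k i ρ =>
    obtain ⟨a, op, b, m, h, h', h''⟩ := h
    exact ⟨a, op, b, m, h.succ h1, h'.succ, h''⟩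
  | readDone k =>
    obtain ⟨a, op, b, h, h', h''⟩ := h
    exact ⟨a, op, b, h.succ h1, h'.succ, h''⟩
  | putConfig a i =>
    cases a with
    | traverse k => exact hreading h
    | added c => exact ⟨hrun h.1, h.2⟩
    | finalizing => exact hrun' h
  | putConfigWait a i B =>
    cases a with
    | traverse k => exact hreading h
    | added c => exact ⟨hrun h.1, h.2⟩
    | finalizing => exact hrun' h
  | getTag v i t => exact h.imp fun m h => htag h
  | getTagWait v i t => exact h.imp fun m h => ⟨htag h.1, fun e he => (h.2 e he).succ h2⟩
  | getData op i M => exact h.imp fun m h => hdata h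
  | getDataWait op i M => exact h.imp fun m h => ⟨hdata h.1, fun e he => (h.2 e he).succ h2⟩
  | putData op x => exact hput h
  | putDataWait op x => exact ⟨hput h.1, fun e he => (h.2 e he).succ h2⟩
  | propose c => exact hrun h
  | proposeWait c => exact hrun h
  | finalize => exact ⟨hrun' h.1, fun e he => (h.2 e he).mono n.le_succ⟩
  | returning r =>
    obtain ⟨a, op, h, h'⟩ := h
    exact ⟨a, op, h.succ h1, h'.imp_right fun ⟨x, hr, hx⟩ => ⟨x, hr, hx.succ⟩⟩

variable {L : Local S C V W}

theorem ClientInv.of_phase (h : ξ.ClientInv n p L) {n' : ℕ} (hn : n ≤ n')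
    (hph : ξ.PhaseInv n' p L.cseq L.rid L.phase) : ξ.ClientInv n' p L where
  seq := h.seq.mono hn
  set i c hi hw hc := (h.set i c hi hw hc).mono hn
  ack a i B e hp he s hs := nextC_ne_none_mono hn (h.ack a i B e hp he s hs)
  ans k i ρ e hp he s x hx :=
    ⟨fun f hf => ((h.ans k i ρ e hp he s x hx).1 f hf).mono hn, (h.ans k i ρ e hp he s x hx).2⟩
  phase := hph

theorem ClientInv.succ (h : ξ.ClientInv n p L) (h1 : ∀ r, ξ.act n ≠ .respond p r)
    (h2 : ∀ c ret, ξ.act n ≠ .dapRespond p c ret) : ξ.ClientInv (n + 1) p L :=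
  h.of_phase n.le_succ (h.phase.succ h1 h2)

/-- Once a quorum has acknowledged the current `put-config`, the successors of all but the last
configuration of the sequence are known to a quorum. -/
theorem ClientInv.quorumSet (h : ξ.ClientInv n p L) {a : PutCont C V W} {i : ℕ} {B : Set S}
    {e : Entry C} {Q : Finset S} (hp : L.phase = .putConfigWait a i B) (he : L.cseq[i]? = some e)
    (hQ : Q ∈ A.quorums e.1) (hall : ∀ s ∈ Q, s ∈ B) :
    ∀ j c, j + 1 < L.cseq.length → ξ.At j c → ξ.QuorumSet n c := by
  intro j c hj hc
  by_cases hji : j = i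
  · subst hji
    rw [hc.unique (h.seq _ _ he).1]
    exact ⟨Q, hQ, fun s hs => h.ack a j B e hp he s (hall s hs)⟩
  · refine h.set j c hj ?_ hc
    rw [hp]
    simpa [Phase.writing] using Ne.symm hji

/-- Change of the program counter, outside of `put-config` and of the waiting phases. -/
theorem ClientInv.goto (h : ξ.ClientInv n p L) {φ : Phase S C V W}
    (hset : ∀ i c, i + 1 < L.cseq.length → ξ.At i c → ξ.QuorumSet n c)
    (hack : ∀ a i B, φ ≠ .putConfigWait a i B) (hans : ∀ k i ρ, φ ≠ .readNextWait k i ρ)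
    (hph : ξ.PhaseInv n p L.cseq L.rid φ) : ξ.ClientInv n p { L with phase := φ } where
  seq := h.seq
  set i c hi _ hc := hset i c hi hc
  ack a i B _ hp := absurd hp (hack a i B)
  ans k i ρ _ hp := absurd hp (hans k i ρ)
  phase := hph

theorem ClientInv.set_all (h : ξ.ClientInv n p L) (hw : L.phase.writing = none) :
    ∀ i c, i + 1 < L.cseq.length → ξ.At i c → ξ.QuorumSet n c :=
  fun i c hi hc => h.set i c hi (by simp [hw]) hc

theorem isLastFinal_fin (h : ξ.ClientInv n p L) {μ : ℕ} (hμ : IsLastFinal L.cseq μ) :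
    ∃ e, L.cseq[μ]? = some e ∧ ξ.Finalized n e.1 := by
  obtain ⟨⟨c, hc⟩, -⟩ := hμ
  exact ⟨_, hc, (h.seq _ _ hc).2 rfl⟩

/-- A query starts. -/
theorem ClientInv.query (h : ξ.ClientInv n p L)
    (hset : ∀ i c, i + 1 < L.cseq.length → ξ.At i c → ξ.QuorumSet n c) {μ : ℕ}
    (hμ : IsLastFinal L.cseq μ) (T : Set (Tag W)) : ξ.Query n L.cseq μ μ T where
  seq j g hg := (h.seq j g hg).1
  set := hset
  fin := isLastFinal_fin h hμ
  got _ _ h1 h2 := absurd h1 (not_le.mpr h2)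

/-- A query obtains an answer from the next configuration. -/
theorem Query.next {m : ℕ} {l : List (Entry C)} {μ i : ℕ} {T T' : Set (Tag W)}
    (h : ξ.Query m l μ i T) (hT : ∀ t ∈ T, ∃ t' ∈ T', t ≤ t') {e : Entry C}
    (he : l[i]? = some e) {t : Tag W} (ht : t ∈ T') (hgot : ξ.Got m e.1 t) :
    ξ.Query m l μ (i + 1) T' where
  seq := h.seq
  set := h.set
  fin := h.fin
  got j g h1 h2 hg := by
    rcases Nat.lt_succ_iff_lt_or_eq.mp h2 with h2 | rfl
    · obtain ⟨t, ht, hgot⟩ := h.got j g h1 h2 hg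
      obtain ⟨t', ht', hle⟩ := hT t ht
      exact ⟨t', ht', hgot.mono hle⟩
    · rw [he] at hg
      cases hg
      exact ⟨t, ht, hgot⟩

theorem Query.max {m : ℕ} {l : List (Entry C)} {μ i : ℕ} {T : Set (Tag W)}
    (h : ξ.Query m l μ i T) {t : Tag W} (ht : ∀ t' ∈ T, t' ≤ t) : ξ.Query m l μ i {t} where
  seq := h.seq
  set := h.set
  fin := h.fin
  got j g h1 h2 hg := by
    obtain ⟨t', ht', hgot⟩ := h.got j g h1 h2 hg
    exact ⟨t, rfl, hgot.mono (ht t' ht')⟩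

end Execution

namespace Execution

variable {S C V W R G : Type*} [LinearOrder W] {A : System S C V} {ξ : Execution W R G A}
  {n : ℕ} {p : Client W R G}

open Classical in
/-- It suffices to consider the client that takes the step. -/
theorem Inv.update (ih : ξ.Inv n) {q : Client W R G} {L : Local S C V W}
    (hcl : (ξ.state (n + 1)).client = Function.update (ξ.state n).client q L)
    (hact : ∀ p, (ξ.act n).actor = some p → p = q) (h : ξ.ClientInv (n + 1) q L) :
    ∀ p, ξ.ClientInv (n + 1) p ((ξ.state (n + 1)).client p) := by
  intro p
  rw [hcl, Function.update_apply]
  split_ifs with hp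
  · exact hp ▸ h
  · refine (ih.client p).succ (fun r hr => hp (hact p ?_)) (fun c ret hr => hp (hact p ?_)) <;>
      rw [hr] <;> rfl

/-- A client sends its `read-next-config` requests. The time of sending is recorded, since every
answer of the servers is later. -/
theorem Inv.reading_sent (ih : ξ.Inv n) (ha : ∀ p, (ξ.act n).actor ≠ some p) {k : ReadCont C V W}
    {i : ℕ} (hp : ((ξ.state n).client p).phase = .readNext k i) :
    ξ.ClientInv (n + 1) p { (ξ.state n).client p with
      rid := ((ξ.state n).client p).rid + 1, phase := .readNextWait k i ∅ } := by
  have h := ih.client p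
  have hph := h.phase
  rw [hp] at hph
  obtain ⟨a, op, b, hrun, hread⟩ := hph
  refine ⟨h.seq.mono n.le_succ, fun j c hj _ hc => ?_, by simp, ?_, ?_⟩
  · exact (h.set_all (by rw [hp]; rfl) j c hj hc).mono n.le_succ
  · rintro k' i' ρ e hρ - s x hx
    cases hρ
    exact absurd hx (Set.notMem_empty _)
  · exact ⟨a, op, b, n, hrun.succ (fun r hr => ha p (by rw [hr]; rfl)), hread.succ,
      (hread.lt hrun).le, Nat.lt_succ_self _, h.set_all (by rw [hp]; rfl)⟩

/-- A `read-config` that finds no successor has reached the end of the sequence, and the last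
configuration had no known successor at some time after the start of the `read-config`. -/
theorem ClientInv.fresh {L : Local S C V W} (h : ξ.ClientInv n p L) {k : ReadCont C V W} {i : ℕ}
    {ρ : Set (S × Option (Entry C))} {e : Entry C} {Q : Finset S}
    (hp : L.phase = .readNextWait k i ρ) (he : L.cseq[i]? = some e) (hQ : Q ∈ A.quorums e.1)
    (hall : ∀ s ∈ Q, ∃ x, (s, x) ∈ ρ) (hout : NextOutcome ρ Q none) :
    ∃ a op b, ξ.Running n p a op ∧ ξ.ReadInv n p L.cseq a op b k ∧ ξ.Fresh b L.cseq := by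
  have hph := h.phase
  rw [hp] at hph
  obtain ⟨a, op, b, m, hrun, hread, hbm, hrid, hset⟩ := hph
  have hunset : ξ.QuorumUnset m e.1 := by
    refine ⟨Q, hQ, fun s hs => ?_⟩
    obtain ⟨x, hx⟩ := hall s hs
    cases hout with
    | bot hbot =>
      have hnone : x = none := by
        cases x with
        | none => rfl
        | some f => exact absurd hx (hbot s hs f)
      obtain ⟨m', hm', hm''⟩ := (h.ans k i ρ e hp he s x hx).2 hnone
      refine ⟨m', ?_, hm''⟩
      by_contra hle
      have : ((ξ.state m').client p).rid ≤ ((ξ.state m).client p).rid :=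
        ξ.rid_mono p (not_lt.mp hle)
      omega
  have hi := lt_length_of_getElem? he
  have hlast : ¬ i + 1 < L.cseq.length := fun hlt => by
    have := (hset i e.1 hlt (h.seq _ _ he).1).gt_of_unset hunset
    omega
  refine ⟨a, op, b, hrun, hread, e, ?_, ?_⟩
  · rw [List.getLast?_eq_getElem?, ← he]
    congr 1
    omega
  · obtain ⟨Q, hQ, hu⟩ := hunset
    exact ⟨Q, hQ, fun s hs => (hu s hs).imp fun m' hm' => ⟨hbm.trans_lt hm'.1, hm'.2⟩⟩

/-- An entry reported by a quorum is stored as the successor of the configuration asked. -/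
theorem ClientInv.found {L : Local S C V W} (h : ξ.ClientInv n p L) {k : ReadCont C V W} {i : ℕ}
    {ρ : Set (S × Option (Entry C))} {e e' : Entry C} {Q : Finset S}
    (hp : L.phase = .readNextWait k i ρ) (he : L.cseq[i]? = some e)
    (hout : NextOutcome ρ Q (some e')) :
    ξ.ClientInv n p { L with
      cseq := assign L.cseq (i + 1) e', phase := .putConfig (.traverse k) i } := by
  have hent : ξ.EntryInv n e.1 e' := by
    generalize hx : some e' = x at hout
    cases hout with
    | fin s d hs hsd => exact (h.ans k i ρ e hp he s _ hsd).1 e' hx.symm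
    | pend s d hs hsd => exact (h.ans k i ρ e hp he s _ hsd).1 e' hx.symm
    | bot => cases hx
  have hi := lt_length_of_getElem? he
  have hlen := length_assign (l := L.cseq) (i := i + 1) (e := e') hi
  have hph := h.phase
  rw [hp] at hph
  obtain ⟨a, op, b, m, hrun, hread, -⟩ := hph
  refine ⟨h.seq.assign he hent, ?_, by simp, by simp, ?_⟩
  · intro j c hj hw hc
    have hji : j ≠ i := fun hji => hw (by rw [hji]; rfl)
    refine h.set_all (by rw [hp]; rfl) j c ?_ hc
    change j + 1 < (Ares.assign L.cseq (i + 1) e').length at hj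
    omega
  · exact ⟨a, op, b, hrun, hread.of_length_le (hlen.ge.trans' (le_max_left _ _))⟩

/-- A reconfiguration extends its sequence by the decision. -/
theorem ClientInv.added {L : Local S C V W} (h : ξ.ClientInv n p L) {c d : C} {e : Entry C}
    (hp : L.phase = .proposeWait c) (he : L.cseq.getLast? = some e) (hd : ξ.Decides e.1 d) :
    ξ.ClientInv n p { L with
      cseq := L.cseq ++ [(d, .pending)], phase := .putConfig (.added c) (L.cseq.length - 1) } := by
  obtain ⟨hpos, he⟩ := getLast?_eq_some he
  have hph := h.phase
  rw [hp] at hph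
  refine ⟨?_, ?_, by simp, by simp, hph, ?_, d, ?_⟩
  · intro j g hg
    dsimp only at hg
    rcases lt_or_ge j L.cseq.length with hj | hj
    · rw [List.getElem?_append_left hj] at hg
      exact h.seq j g hg
    · rw [List.getElem?_append_right hj] at hg
      have hj0 := lt_length_of_getElem? hg
      rw [List.length_singleton] at hj0
      have hj' : j = L.cseq.length - 1 + 1 := by omega
      rw [show j - L.cseq.length = 0 by omega] at hg
      cases hg
      rw [hj']
      exact ⟨.succ (h.seq _ _ he).1 hd, by simp⟩
  · intro j c' hj hw hc
    refine h.set_all (by rw [hp]; rfl) j c' ?_ hc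
    have : j ≠ L.cseq.length - 1 := fun hji => hw (by rw [hji]; rfl)
    simp only [List.length_append, List.length_singleton] at hj
    omega
  · simp only [List.length_append, List.length_singleton]
    omega
  · rw [List.getElem?_append_right (by omega)]
    rw [show L.cseq.length - 1 + 1 - L.cseq.length = 0 by omega]
    rfl

/-- The last configuration of a reconfiguration is finalized after a tag that dominates its query
was put into it. -/
theorem Query.fin_of_put {m : ℕ} {l : List (Entry C)} {μ : ℕ} {t : Tag W}
    (h : ξ.Query m l μ l.length {t}) (hlt : μ + 1 < l.length) {e : Entry C}
    (he : l.getLast? = some e) (hput : ξ.Put n e.1 t) : ξ.Finalized n e.1 := by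
  obtain ⟨f, hf, hfin⟩ := h.fin
  refine .step h.seq h.set hf hfin he hlt (fun j g hj hg => ?_) hput
  obtain ⟨t', rfl, hgot⟩ := h.got j g hj (lt_length_of_getElem? hg) hg
  exact hgot

theorem TagQuery.next {l : List (Entry C)} {v : V} {i m : ℕ} {t t' : Tag W} {e : Entry C}
    (h : ξ.TagQuery n p l v i t m) (he : l[i]? = some e)
    (hpend : ξ.Pending m n p e.1 .getTag) (ha : ξ.act n = .dapRespond p e.1 (.tag t')) :
    ξ.TagQuery (n + 1) p l v (i + 1) (max t' t) m := by
  obtain ⟨a, μ, hrun, ham, hmn, hfresh, hq⟩ := h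
  obtain ⟨j, hmj, hj⟩ := hpend.complete ha
  exact ⟨a, μ, hrun.succ (by simp [ha]), ham, hmn.trans n.le_succ, hfresh,
    hq.next (fun s hs => ⟨_, rfl, hs ▸ le_max_right _ _⟩) he rfl
      ⟨p, j, n, t', hmj, le_max_left _ _, .inl hj⟩⟩

theorem DataQuery.next {l : List (Entry C)} {op : Op C V} {i m : ℕ} {M : Set (Tag W × V)}
    {t : Tag W} {v : V} {e : Entry C} (h : ξ.DataQuery n p l op i M m) (he : l[i]? = some e)
    (hpend : ξ.Pending m n p e.1 .getData) (ha : ξ.act n = .dapRespond p e.1 (.pair t v))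
    (hC2 : ξ.C2 e.1) (hputs : ∀ i < n, ∀ q c t v,
      ξ.act i = .dapInvoke q c (.putData t v) → ξ.Sourced (t, v)) :
    ξ.DataQuery (n + 1) p l op (i + 1) (insert (t, v) M) m := by
  obtain ⟨a, μ, hrun, ham, hmn, hq, hsrc, hop⟩ := h
  obtain ⟨j, hmj, hj⟩ := hpend.complete ha
  have htv : ξ.Sourced (t, v) := by
    rcases hC2 p t v j n hj with ⟨q, i', hi', hq'⟩ | h
    · exact hputs i' hi' q _ t v hq'
    · exact .inl h
  refine ⟨a, μ, hrun.succ (by simp [ha]), ham, hmn.trans n.le_succ, ?_, ?_, hop⟩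
  · exact hq.next
      (fun s hs => ⟨s, Set.image_mono (Set.subset_insert _ _) hs, le_rfl⟩) he
      ⟨_, Set.mem_insert _ _, rfl⟩ ⟨p, j, n, t, hmj, le_rfl, .inr ⟨v, hj⟩⟩
  · rintro x (rfl | hx)
    · exact htv
    · exact hsrc x hx

theorem DataQuery.putInv {l : List (Entry C)} {op : Op C V} {m : ℕ} {M : Set (Tag W × V)}
    {x : Tag W × V} (h : ξ.DataQuery n p l op l.length M m) (hx : x ∈ M)
    (hmax : ∀ y ∈ M, y.1 ≤ x.1) : ξ.PutInv n p l op x := by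
  obtain ⟨a, μ, hrun, ham, hmn, hq, hsrc, hop⟩ := h
  have hq' := hq.max (t := x.1) (by rintro _ ⟨y, hy, rfl⟩; exact hmax y hy)
  refine ⟨a, hrun, ?_⟩
  cases op with
  | read => exact .inl ⟨m, l, μ, x.1, ham, hop, hq', rfl, hsrc x hx⟩
  | write v => exact hop.elim
  | reconfig c => exact .inr ⟨⟨c, rfl⟩, hsrc x hx, m, μ, hq', hop⟩

theorem Started.ne_reconfig {a : ℕ} {op : Op C V} {x : Tag W × V} (h : ξ.Started p a op x) :
    ∀ c, op ≠ .reconfig c := by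
  rintro c rfl
  obtain ⟨_, _, _, _, _, _, _, h⟩ := h
  exact h

/-- The `put-data` of a read or write returns. -/
theorem ClientInv.recheck {L : Local S C V W} (h : ξ.ClientInv n p L) {op : Op C V}
    {x : Tag W × V} {e : Entry C} (hp : L.phase = .putDataWait op x) (hop : ∀ c, op ≠ .reconfig c)
    (he : L.cseq.getLast? = some e) (ha : ξ.act n = .dapRespond p e.1 .ack) :
    ξ.ClientInv (n + 1) p
      { L with phase := .readConfig (.recheck op x L.cseq.length) } := by
  have hph := h.phase
  rw [hp] at hph
  obtain ⟨⟨a, hrun, hst⟩, hpend⟩ := hph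
  have hst : ξ.Started p a op x := hst.resolve_right fun h => hop _ h.1.choose_spec
  obtain ⟨i, -, hi⟩ := (hpend e he).complete ha
  obtain ⟨hpos, he⟩ := getLast?_eq_some he
  refine ⟨h.seq.mono n.le_succ,
    fun j c hj _ hc => (h.set_all (by rw [hp]; rfl) j c hj hc).mono n.le_succ, by simp, by simp,
    a, op, n, hrun.succ (by simp [ha]), rfl, hst, hrun.1, n.lt_succ_self, hpos, le_rfl, e.1, i,
    (h.seq _ _ he).1, hi⟩

/-- A read or write ends if its last `read-config` found no new configuration. -/
theorem ClientInv.finished {L : Local S C V W} (h : ξ.ClientInv n p L) {op : Op C V}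
    {x : Tag W × V} (hp : L.phase = .readDone (.recheck op x L.cseq.length))
    (hcar : ∀ a, ξ.Running n p a op → (∀ c, op ≠ .reconfig c) → ξ.HasPair a x) :
    ξ.ClientInv n p { L with phase := .returning (op.result x) } := by
  have hph := h.phase
  rw [hp] at hph
  obtain ⟨a, op', b, hrun, ⟨rfl, hst, hab, hbn, hpos, -, c, i, hc, hi⟩, e, he, hu⟩ := hph
  have hset := h.set_all (by rw [hp]; rfl)
  obtain ⟨-, he⟩ := getLast?_eq_some he
  rw [(h.seq _ _ he).1.unique hc] at hu
  refine h.goto hset (by simp) (by simp) ⟨a, op, hrun, .inr ⟨x, rfl, hcar a hrun hst.ne_reconfig,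
    hst, L.cseq.length - 1, c, i, b, hc, hi, hab, hbn, hu,
    fun j d hj hd => hset j d (by omega) hd⟩⟩

/-- The knowledge about the clients is preserved by every step. -/
theorem Inv.client_succ (ih : ξ.Inv n) (hC2 : ∀ c, ξ.C2 c) :
    ∀ p, ξ.ClientInv (n + 1) p ((ξ.state (n + 1)).client p) := by
  have hs := ξ.step n
  have hmsg := ξ.msgInv (n := n)
  generalize ha : ξ.act n = a at hs
  generalize hσ : ξ.state (n + 1) = σ' at hs
  have key : a = .internal → σ'.client = (ξ.state n).client →
      ∀ p, ξ.ClientInv (n + 1) p (σ'.client p) := fun h1 h2 p => by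
    rw [h2]
    exact (ih.client p).succ (by simp [ha, h1]) (by simp [ha, h1])
  rw [← hσ]
  cases hs
  case stutter => rw [hσ]; exact key rfl rfl
  case serverRead => rw [hσ]; exact key rfl rfl
  case serverWrite => rw [hσ]; exact key rfl rfl
  case serverKeep => rw [hσ]; exact key rfl rfl
  case invoke p op hp hop =>
    refine ih.update (by rw [hσ]; rfl) (by simp [ha, Act.actor]) ?_
    have h := (ih.client p).succ (by simp [ha]) (by simp [ha])
    refine h.goto (h.set_all (by rw [hp]; rfl)) (by simp) (by simp) ?_
    exact ⟨n, op, n, ⟨n.lt_succ_self, ha, fun k hk hkn => by omega⟩, rfl, rfl⟩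
  case respond p r hp =>
    refine ih.update (by rw [hσ]; rfl) (by simp [ha, Act.actor]) ?_
    have h := ih.client p
    exact ⟨h.seq.mono n.le_succ,
      fun j c hj _ hc => (h.set_all (by rw [hp]; rfl) j c hj hc).mono n.le_succ, by simp, by simp,
      trivial⟩
  case readConfig p k μ hp hμ =>
    refine ih.update (by rw [hσ]; rfl) (by simp [ha, Act.actor]) ?_
    have h := (ih.client p).succ (by simp [ha]) (by simp [ha])
    have hph := h.phase
    rw [hp] at hph
    exact h.goto (h.set_all (by rw [hp]; rfl)) (by simp) (by simp) hph
  case readNext p k i e hp he =>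
    exact ih.update (by rw [hσ]; rfl) (by simp [ha, Act.actor])
      (ih.reading_sent (by simp [ha, Act.actor]) hp)
  case readNextReply p k i ρ r s c x hp hr hm =>
    refine ih.update (by rw [hσ]; rfl) (by simp [ha, Act.actor]) ?_
    have h := (ih.client p).succ (by simp [ha]) (by simp [ha])
    have hph := h.phase
    rw [hp] at hph
    refine ⟨h.seq, fun j c hj _ hc => h.set_all (by rw [hp]; rfl) j c hj hc, by simp, ?_, hph⟩
    rintro k' i' ρ' e hρ he s' x' hx
    cases hρ
    rcases hx with hx | hx
    · cases hx
      obtain ⟨⟨-, haddr⟩, hunset⟩ := hmsg _ hm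
      obtain rfl : e.1 = c := haddr hr.symm e.1 (by
        have he' : ((ξ.state n).client p).cseq[i]? = some e := he
        simp [Local.target, hp, he'])
      refine ⟨?_, fun hx => by rw [← hr] at hunset; exact hunset hx⟩
      rintro f rfl
      exact (ih.msg _ hm : ξ.EntryInv n e.1 f).mono n.le_succ
    · exact h.ans k i ρ e hp he s' x' hx
  case readNextSome p k i ρ e Q e' hp he hQ hall hout =>
    exact ih.update (by rw [hσ]; rfl) (by simp [ha, Act.actor])
      (((ih.client p).succ (by simp [ha]) (by simp [ha])).found hp he hout)
  case readNextNone p k i ρ e Q hp he hQ hall hout =>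
    refine ih.update (by rw [hσ]; rfl) (by simp [ha, Act.actor]) ?_
    have h := (ih.client p).succ (by simp [ha]) (by simp [ha])
    exact h.goto (h.set_all (by rw [hp]; rfl)) (by simp) (by simp)
      (h.fresh hp he hQ hall hout)
  case putConfig p a i e e' hp he he' =>
    refine ih.update (by rw [hσ]; rfl) (by simp [ha, Act.actor]) ?_
    have h := (ih.client p).succ (by simp [ha]) (by simp [ha])
    have hph := h.phase
    rw [hp] at hph
    refine ⟨h.seq, fun j c hj hw hc => h.set j c hj (by rw [hp]; exact hw) hc, ?_, by simp, ?_⟩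
    · rintro a' i' B e hB - s hs
      cases hB
      exact absurd hs (Set.notMem_empty _)
    · cases a <;> exact hph
  case putConfigAck p a i B r s c hp hr hm =>
    refine ih.update (by rw [hσ]; rfl) (by simp [ha, Act.actor]) ?_
    have h := (ih.client p).succ (by simp [ha]) (by simp [ha])
    have hph := h.phase
    rw [hp] at hph
    refine ⟨h.seq, fun j c hj hw hc => h.set j c hj (by rw [hp]; exact hw) hc, ?_, by simp, ?_⟩
    · rintro a' i' B' e hB he s' hs'
      cases hB
      rcases hs' with rfl | hs'
      · obtain ⟨⟨-, haddr⟩, hne⟩ := hmsg _ hm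
        obtain rfl : e.1 = c := haddr hr.symm e.1 (by
          have he' : ((ξ.state n).client p).cseq[i]? = some e := he
          simp [Local.target, hp, he'])
        exact nextC_ne_none_mono n.le_succ hne
      · exact h.ack a i B e hp he s' hs'
    · cases a <;> exact hph
  case putConfigTraverse p k i B e Q hp he hQ hall =>
    refine ih.update (by rw [hσ]; rfl) (by simp [ha, Act.actor]) ?_
    have h := (ih.client p).succ (by simp [ha]) (by simp [ha])
    have hph := h.phase
    rw [hp] at hph
    exact h.goto (h.quorumSet hp he hQ hall) (by simp) (by simp) hph
  case putConfigAdded p c i B e Q μ hp he hQ hall hμ =>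
    refine ih.update (by rw [hσ]; rfl) (by simp [ha, Act.actor]) ?_
    have h := (ih.client p).succ (by simp [ha]) (by simp [ha])
    have hph := h.phase
    rw [hp] at hph
    obtain ⟨⟨a, hrun⟩, hlen, d, hd⟩ := hph
    have hset := h.quorumSet hp he hQ hall
    refine h.goto hset (by simp) (by simp)
      ⟨n + 1, a, μ, hrun, hrun.1, le_rfl, h.query hset hμ _, by simp, ?_⟩
    -- the new entry at index `i + 1` is pending, so `μ` is an earlier index
    obtain ⟨⟨c', hc'⟩, -⟩ := hμ
    have h1 := lt_length_of_getElem? hc'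
    have h2 : μ ≠ i + 1 := by
      rintro rfl
      rw [hd] at hc'
      cases hc'
    change μ + 1 < ((ξ.state n).client p).cseq.length
    omega
  case putConfigFinalizing p i B e Q hp he hQ hall =>
    refine ih.update (by rw [hσ]; rfl) (by simp [ha, Act.actor]) ?_
    have h := (ih.client p).succ (by simp [ha]) (by simp [ha])
    have hph := h.phase
    rw [hp] at hph
    obtain ⟨a, c, hrun⟩ := hph
    exact h.goto (h.quorumSet hp he hQ hall) (by simp) (by simp) ⟨a, _, hrun, .inl ⟨c, rfl⟩⟩
  case writeStart p v μ hp hμ =>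
    refine ih.update (by rw [hσ]; rfl) (by simp [ha, Act.actor]) ?_
    have h := (ih.client p).succ (by simp [ha]) (by simp [ha])
    have hph := h.phase
    rw [hp] at hph
    obtain ⟨a, op, b, hrun, ⟨rfl, rfl⟩, hfresh⟩ := hph
    have hset := h.set_all (by rw [hp]; rfl)
    exact h.goto hset (by simp) (by simp)
      ⟨n + 1, b, μ, hrun, hrun.1, le_rfl, hfresh, h.query hset hμ _⟩
  case getTagInvoke p v i t e hp he =>
    refine ih.update (by rw [hσ]; rfl) (by simp [ha, Act.actor]) ?_
    have h := (ih.client p).succ (by simp [ha]) (by simp [ha])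
    have hph := (ih.client p).phase
    rw [hp] at hph
    obtain ⟨m, a, μ, hrun, ham, hmn, hq⟩ := hph
    refine h.goto (h.set_all (by rw [hp]; rfl)) (by simp) (by simp)
      ⟨m, ⟨a, μ, hrun.succ (by simp [ha]), ham, hmn.trans n.le_succ, hq⟩, fun f hf => ?_⟩
    obtain rfl : e = f := Option.some.inj (he.symm.trans hf)
    exact .of_invoke hmn ha
  case getTagRespond p v i t e t' hp he =>
    refine ih.update (by rw [hσ]; rfl) (by simp [ha, Act.actor]) ?_
    have h := ih.client p
    have hph := h.phase
    rw [hp] at hph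
    obtain ⟨m, hq, hpend⟩ := hph
    exact ⟨h.seq.mono n.le_succ,
      fun j c hj _ hc => (h.set_all (by rw [hp]; rfl) j c hj hc).mono n.le_succ, by simp, by simp,
      m, hq.next he (hpend e he) ha⟩
  case getTagEnd w v t hp =>
    refine ih.update (by rw [hσ]; rfl) (by simp [ha, Act.actor]) ?_
    have h := (ih.client (.writer w)).succ (by simp [ha]) (by simp [ha])
    have hph := h.phase
    rw [hp] at hph
    obtain ⟨m, a, μ, hrun, ham, -, hfresh, hq⟩ := hph
    exact h.goto (h.set_all (by rw [hp]; rfl)) (by simp) (by simp)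
      ⟨a, hrun, .inl ⟨m, _, μ, t, ham, hfresh, hq, rfl, w, rfl, rfl⟩⟩
  case readStart p μ hp hμ =>
    refine ih.update (by rw [hσ]; rfl) (by simp [ha, Act.actor]) ?_
    have h := (ih.client p).succ (by simp [ha]) (by simp [ha])
    have hph := h.phase
    rw [hp] at hph
    obtain ⟨a, op, b, hrun, ⟨rfl, rfl⟩, hfresh⟩ := hph
    have hset := h.set_all (by rw [hp]; rfl)
    refine h.goto hset (by simp) (by simp)
      ⟨n + 1, b, μ, hrun, hrun.1, le_rfl, h.query hset hμ _, ?_, hfresh⟩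
    rintro x rfl
    exact .inl rfl
  case getDataInvoke p op i M e hp he =>
    refine ih.update (by rw [hσ]; rfl) (by simp [ha, Act.actor]) ?_
    have h := (ih.client p).succ (by simp [ha]) (by simp [ha])
    have hph := (ih.client p).phase
    rw [hp] at hph
    obtain ⟨m, a, μ, hrun, ham, hmn, hq⟩ := hph
    refine h.goto (h.set_all (by rw [hp]; rfl)) (by simp) (by simp)
      ⟨m, ⟨a, μ, hrun.succ (by simp [ha]), ham, hmn.trans n.le_succ, hq⟩, fun f hf => ?_⟩
    obtain rfl : e = f := Option.some.inj (he.symm.trans hf)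
    exact .of_invoke hmn ha
  case getDataRespond p op i M e t v hp he =>
    refine ih.update (by rw [hσ]; rfl) (by simp [ha, Act.actor]) ?_
    have h := ih.client p
    have hph := h.phase
    rw [hp] at hph
    obtain ⟨m, hq, hpend⟩ := hph
    exact ⟨h.seq.mono n.le_succ,
      fun j c hj _ hc => (h.set_all (by rw [hp]; rfl) j c hj hc).mono n.le_succ, by simp, by simp,
      m, hq.next he (hpend e he) ha (hC2 _) ih.puts⟩
  case getDataEnd p op M x hp hx hmax =>
    refine ih.update (by rw [hσ]; rfl) (by simp [ha, Act.actor]) ?_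
    have h := (ih.client p).succ (by simp [ha]) (by simp [ha])
    have hph := h.phase
    rw [hp] at hph
    obtain ⟨m, hq⟩ := hph
    exact h.goto (h.set_all (by rw [hp]; rfl)) (by simp) (by simp) (hq.putInv hx hmax)
  case putDataInvoke p op x e hp he =>
    refine ih.update (by rw [hσ]; rfl) (by simp [ha, Act.actor]) ?_
    have h := (ih.client p).succ (by simp [ha]) (by simp [ha])
    have hph := h.phase
    rw [hp] at hph
    refine h.goto (h.set_all (by rw [hp]; rfl)) (by simp) (by simp) ⟨hph, fun f hf => ?_⟩
    obtain rfl : e = f := Option.some.inj (he.symm.trans hf)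
    exact .of_invoke n.zero_le ha
  case putDataRespondRead p x e hp he =>
    exact ih.update (by rw [hσ]; rfl) (by simp [ha, Act.actor])
      ((ih.client p).recheck hp (by simp) he ha)
  case putDataRespondWrite p v x e hp he =>
    exact ih.update (by rw [hσ]; rfl) (by simp [ha, Act.actor])
      ((ih.client p).recheck hp (by simp) he ha)
  case putDataRespondReconfig p c x e hp he =>
    refine ih.update (by rw [hσ]; rfl) (by simp [ha, Act.actor]) ?_
    have h := ih.client p
    have hph := h.phase
    rw [hp] at hph
    obtain ⟨⟨a, hrun, hst⟩, hpend⟩ := hph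
    obtain ⟨-, -, m, μ, hq, hlt⟩ := hst.resolve_left fun hst => hst.ne_reconfig c rfl
    obtain ⟨i, -, hi⟩ := (hpend e he).complete ha
    refine ⟨h.seq.mono n.le_succ,
      fun j c hj _ hc => (h.set_all (by rw [hp]; rfl) j c hj hc).mono n.le_succ, by simp, by simp,
      ⟨a, c, hrun.succ (by simp [ha])⟩, fun f hf => ?_⟩
    obtain rfl : e = f := Option.some.inj (he.symm.trans hf)
    exact hq.fin_of_put hlt he ⟨p, _, _, i, n, hi, n.lt_succ_self, le_rfl⟩
  case recheckEnd p op x ν hp hν =>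
    refine ih.update (by rw [hσ]; rfl) (by simp [ha, Act.actor]) ?_
    have h := (ih.client p).succ (by simp [ha]) (by simp [ha])
    subst hν
    refine h.finished hp fun a hrun hop => ?_
    have hph := (ih.client p).phase
    rw [hp] at hph
    obtain ⟨a', op', b, hrun', ⟨rfl, -⟩, -⟩ := hph
    obtain ⟨rfl, -⟩ := hrun.unique (hrun'.succ (by simp [ha]))
    exact ⟨p, op, n, hrun', hop, by rw [hp]; rfl⟩
  case recheckLoop p op x ν hp hν =>
    refine ih.update (by rw [hσ]; rfl) (by simp [ha, Act.actor]) ?_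
    have h := (ih.client p).succ (by simp [ha]) (by simp [ha])
    have hph := h.phase
    rw [hp] at hph
    obtain ⟨a, op', b, hrun, ⟨rfl, hst, -⟩, -⟩ := hph
    exact h.goto (h.set_all (by rw [hp]; rfl)) (by simp) (by simp) ⟨a, hrun, .inl hst⟩
  case reconfigStart p c hp =>
    refine ih.update (by rw [hσ]; rfl) (by simp [ha, Act.actor]) ?_
    have h := (ih.client p).succ (by simp [ha]) (by simp [ha])
    have hph := h.phase
    rw [hp] at hph
    obtain ⟨a, op, b, hrun, ⟨rfl, rfl⟩, -⟩ := hph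
    exact h.goto (h.set_all (by rw [hp]; rfl)) (by simp) (by simp) ⟨b, hrun⟩
  case propose p c e hp he =>
    refine ih.update (by rw [hσ]; rfl) (by simp [ha, Act.actor]) ?_
    have h := (ih.client p).succ (by simp [ha]) (by simp [ha])
    have hph := h.phase
    rw [hp] at hph
    exact h.goto (h.set_all (by rw [hp]; rfl)) (by simp) (by simp) hph
  case decide p c e d hp he hvalid hagree =>
    refine ih.update (by rw [hσ]; rfl) (by simp [ha, Act.actor]) ?_
    have h := (ih.client p).succ (by simp [ha]) (by simp [ha])
    refine h.added hp he ⟨n + 1, ?_⟩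
    rw [hσ]
    simp [State.gotoWith, State.setClient, State.setDecision]
  case finalize p i e hp hlen he =>
    refine ih.update (by rw [hσ]; rfl) (by simp [ha, Act.actor]) ?_
    have h := (ih.client p).succ (by simp [ha]) (by simp [ha])
    have hph := h.phase
    rw [hp] at hph
    have hfin : ξ.Finalized (n + 1) e.1 := hph.2 e (by
      rw [List.getLast?_eq_getElem?, hlen, ← he]; rfl)
    have hi : i < ((ξ.state n).client p).cseq.length := by omega
    refine ⟨h.seq.assign (List.getElem?_eq_getElem hi) ⟨(h.seq.decides
      (List.getElem?_eq_getElem hi) he).1, fun _ => hfin⟩, fun j c hj _ hc => ?_, by simp, by simp,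
      hph.1⟩
    refine h.set_all (by rw [hp]; rfl) j c ?_ hc
    have hl := length_assign (l := ((ξ.state n).client p).cseq) (i := i + 1)
      (e := (e.1, Status.finalized)) (by omega)
    change j + 1 < (Ares.assign ((ξ.state n).client p).cseq (i + 1) (e.1, .finalized)).length at hj
    omega

theorem PutInv.sourced {l : List (Entry C)} {op : Op C V} {x : Tag W × V}
    (h : ξ.PutInv n p l op x) (hx : ((ξ.state n).client p).phase = .putData op x) :
    ξ.Sourced x := by
  obtain ⟨a, hrun, hst | ⟨-, hsrc, -⟩⟩ := h
  · cases op with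
    | read =>
      obtain ⟨_, _, _, _, _, _, _, _, hsrc⟩ := hst
      exact hsrc
    | write v =>
      exact .inr ⟨a, v, ⟨p, hrun.2.1⟩, p, .write v, n, hrun, by simp, by rw [hx]; rfl⟩
    | reconfig c => exact absurd rfl (hst.ne_reconfig c)
  · exact hsrc

theorem inv (hC2 : ∀ c, ξ.C2 c) (n : ℕ) : ξ.Inv n := by
  induction n with
  | zero =>
    refine ⟨fun p => ?_, ?_, ?_, by simp⟩
    · rw [ξ.init]
      refine ⟨?_, by simp [initState], by simp [initState], by simp [initState], trivial⟩
      rintro (_ | i) e he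
      · cases he
        exact ⟨.zero, fun _ => .init _⟩
      · simp [initState] at he
    · simp [ξ.init, initState]
    · simp [ξ.init, initState]
  | succ n ih =>
    have hs := ξ.step n
    refine ⟨ih.client_succ hC2, ?_, ?_, ?_⟩
    · intro m hm
      rcases hs.net hm with h | ⟨p, s, c, rfl, -⟩ | ⟨p, s, c, e, rfl, -, i, f, hf, rfl, he⟩ |
        ⟨p, r, s, c, rfl, -⟩ | ⟨p, r, s, c, e, rfl, -⟩
      · have h := ih.msg m h
        cases m with
        | nextConfig p r s c x =>
          cases x with
          | none => trivial
          | some e => exact EntryInv.mono n.le_succ h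
        | writeConfig => exact EntryInv.mono n.le_succ h
        | _ => trivial
      · trivial
      · exact ((ih.client p).seq.decides hf he).mono n.le_succ
      · cases hx : (ξ.state n).nextC s c with
        | none => trivial
        | some e => exact (ih.server s c e hx).mono n.le_succ
      · trivial
    · intro s c e he
      rcases hs.nextC he with h | ⟨p, r, h⟩
      · exact (ih.server s c e h).mono n.le_succ
      · exact EntryInv.mono n.le_succ (ih.msg _ h)
    · intro i hi q c t v hact
      rcases Nat.lt_succ_iff_lt_or_eq.mp hi with hi | rfl
      · exact ih.puts i hi q c t v hact
      · rw [hact] at hs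
        obtain ⟨op, hop⟩ := hs.putData_inv
        have hph := (ih.client q).phase
        rw [hop] at hph
        exact PutInv.sourced hph hop

end Execution

/-! ### Atomicity -/

section Tags

variable {W : Type*}

theorem Tag.lt_inc [LinearOrder W] (t : Tag W) (w : W) : t < t.inc w :=
  Prod.Lex.lt_iff.mpr (.inl (Nat.lt_succ_self _))

theorem Tag.lt_inc_of_le [LinearOrder W] {t t' : Tag W} (h : t ≤ t') (w : W) : t < t'.inc w :=
  h.trans_lt (t'.lt_inc w)

theorem tag0_lt_inc [LinearOrder W] (t : Tag W) (w : W) : tag0 W < t.inc w :=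
  Prod.Lex.lt_iff.mpr (.inl (Nat.succ_pos _))

theorem Tag.inc_writer {t t' : Tag W} {w w' : W} (h : t.inc w = t'.inc w') : w = w' :=
  WithBot.coe_injective (congrArg (fun s => (ofLex s).2) h)

end Tags

namespace Execution

variable {S C V W R G : Type*} [LinearOrder W] {A : System S C V} {ξ : Execution W R G A}

theorem ReadInv.started {n : ℕ} {p : Client W R G} {l : List (Entry C)} {a : ℕ} {op op' : Op C V}
    {b : ℕ} {k : ReadCont C V W} {x : Tag W × V} (h : ξ.ReadInv n p l a op b k)
    (hk : k.carried = some (op', x)) : op' = op ∧ ξ.Started p a op x := by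
  cases k with
  | opening => simp [ReadCont.carried] at hk
  | recheck op₁ x₁ ν =>
    cases hk
    exact ⟨h.1, h.2.1⟩

theorem PhaseInv.started {n : ℕ} {p : Client W R G} {l : List (Entry C)} {r : ℕ}
    {φ : Phase S C V W} {op : Op C V} {x : Tag W × V} (h : ξ.PhaseInv n p l r φ)
    (hφ : φ.carried = some (op, x)) (hop : ∀ c, op ≠ .reconfig c) :
    ∃ a, ξ.Running n p a op ∧ ξ.Started p a op x := by
  have hreading : ∀ {k}, ξ.Reading n p l k → k.carried = some (op, x) →
      ∃ a, ξ.Running n p a op ∧ ξ.Started p a op x := by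
    rintro k ⟨a, op', b, hrun, hread⟩ hk
    obtain ⟨rfl, h⟩ := hread.started hk
    exact ⟨a, hrun, h⟩
  have hput : ∀ {op' x'}, ξ.PutInv n p l op' x' → some (op', x') = some (op, x) →
      ∃ a, ξ.Running n p a op ∧ ξ.Started p a op x := by
    rintro op' x' ⟨a, hrun, h⟩ heq
    cases heq
    exact ⟨a, hrun, h.resolve_right fun h => hop _ h.1.choose_spec⟩
  cases φ with
  | readConfig k => exact hreading h hφ
  | readNext k => exact hreading h hφ
  | readNextWait k i ρ =>
    obtain ⟨a, op', b, m, hrun, hread, -⟩ := h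
    exact hreading ⟨a, op', b, hrun, hread⟩ hφ
  | readDone k =>
    obtain ⟨a, op', b, hrun, hread, -⟩ := h
    exact hreading ⟨a, op', b, hrun, hread⟩ hφ
  | putConfig a i =>
    cases a with
    | traverse k => exact hreading h hφ
    | _ => cases hφ
  | putConfigWait a i B =>
    cases a with
    | traverse k => exact hreading h hφ
    | _ => cases hφ
  | putData => exact hput h hφ
  | putDataWait => exact hput h.1 hφ
  | _ => cases hφ

theorem HasPair.started (hC2 : ∀ c, ξ.C2 c) {a : ℕ} {x : Tag W × V} (h : ξ.HasPair a x) :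
    ∃ p op, ξ.act a = .invoke p op ∧ ξ.Started p a op x := by
  obtain ⟨p, op, m, hrun, hop, hx⟩ := h
  obtain ⟨b, hrun', hst⟩ := ((inv hC2 m).client p).phase.started hx hop
  obtain ⟨rfl, -⟩ := hrun.unique hrun'
  exact ⟨p, op, hrun.2.1, hst⟩

theorem Complete.finished (hC2 : ∀ c, ξ.C2 c) {op : Op C V} {r : Option V} {a j : ℕ}
    (h : ξ.Complete op r a j) (hop : ∀ c, op ≠ .reconfig c) :
    ∃ p x, r = op.result x ∧ ξ.Finished j p a op x := by
  obtain ⟨p, ha, haj, hj, hno⟩ := h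
  have hrun : ξ.Running j p a op := ⟨haj, ha, hno⟩
  have hph := ((inv hC2 j).client p).phase
  rw [(hj ▸ ξ.step j : Step A _ (.respond p r) _).respond_inv] at hph
  obtain ⟨b, op', hrun', h⟩ := hph
  obtain ⟨rfl, rfl⟩ := hrun.unique hrun'
  obtain ⟨x, hr, hx⟩ := h.resolve_left fun h => hop _ h.choose_spec
  exact ⟨p, x, hr, hx⟩

/-- The query of an operation invoked after the completion of another one finds a tag at least as
large as the tag of the latter. -/
theorem Finished.le_query (hξ : ξ.DistinctReconfigs) (hC1 : ∀ c, ξ.C1 c) {j : ℕ}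
    {p : Client W R G} {a : ℕ} {op : Op C V} {x : Tag W × V} (h : ξ.Finished j p a op x) {b : ℕ}
    (hjb : j < b) {m : ℕ} (hbm : b < m) {l : List (Entry C)} {μ : ℕ} {t : Tag W}
    (hfresh : ξ.Fresh b l) (hq : ξ.Query m l μ l.length {t}) : x.1 ≤ t := by
  obtain ⟨-, -, k, c, i, T, hc, hput, -, hTj, hu, hset⟩ := h
  obtain ⟨e, he, hue⟩ := hfresh
  obtain ⟨hpos, he⟩ := getLast?_eq_some he
  -- the later operation has traversed the sequence at least up to position `k`
  have hk : k < l.length := by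
    by_contra hle
    have := ((hset _ _ (by omega) (hq.seq _ _ he)).mono hjb.le).gt_of_unset hue
    omega
  have hput' : ∀ n, T < n → ξ.Put n c x.1 := fun n hn => ⟨p, _, _, i, T, hput, hn, le_rfl⟩
  obtain ⟨t', rfl, ht⟩ := hq.exists_le hξ hC1 hc
    (fun n hn => hput' n (by have := hn.gt_of_unset hu; omega)) (hput' m (by omega)) hk
  exact ht

theorem Started.tag_of_write {p : Client W R G} {a : ℕ} {v : V} {x : Tag W × V}
    (h : ξ.Started p a (.write v) x) : x.2 = v ∧ ∃ t w, p = .writer w ∧ x.1 = Tag.inc t w := by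
  obtain ⟨_, _, _, t, _, _, _, hv, w, hw, ht⟩ := h
  exact ⟨hv, t, w, hw, ht⟩

/-- The tags respect the order of non-overlapping operations, strictly if the later one is a
write. -/
theorem HasPair.le_of_precedes (hξ : ξ.DistinctReconfigs) (hC1 : ∀ c, ξ.C1 c)
    (hC2 : ∀ c, ξ.C2 c) {a b : ℕ} {x y : Tag W × V} (hx : ξ.HasPair a x) (hy : ξ.HasPair b y)
    (hab : ξ.Precedes a b) : x.1 ≤ y.1 ∧ ((∃ v, ξ.IsWrite b v) → x.1 < y.1) := by
  obtain ⟨op, r, j, hcomp, hjb⟩ := hab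
  obtain ⟨p, op₁, ha, hst₁⟩ := hx.started hC2
  obtain ⟨p', ha', -⟩ := id hcomp
  rw [ha] at ha'
  obtain ⟨rfl, rfl⟩ := Act.invoke.inj ha'
  obtain ⟨p', x', -, hfin⟩ := hcomp.finished hC2 hst₁.ne_reconfig
  obtain rfl := hx.unique hfin.1
  obtain ⟨q, op', hb, m, l, μ, t, hbm, hfresh, hq, hop⟩ := hy.started hC2
  have ht : x.1 ≤ t := hfin.le_query hξ hC1 hjb hbm hfresh hq
  cases op' with
  | read =>
    refine ⟨ht.trans hop.1.ge, ?_⟩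
    rintro ⟨v, p, hp⟩
    rw [hb] at hp
    cases hp
  | write v =>
    obtain ⟨-, w, -, hy⟩ := hop
    have hlt : x.1 < y.1 := hy ▸ Tag.lt_inc_of_le ht w
    exact ⟨hlt.le, fun _ => hlt⟩
  | reconfig c => exact hop.elim

theorem HasPair.of_write (hC2 : ∀ c, ξ.C2 c) {a : ℕ} {v : V} {x : Tag W × V}
    (hx : ξ.HasPair a x) (ha : ξ.IsWrite a v) :
    x.2 = v ∧ ∃ t w, ξ.act a = .invoke (.writer w) (.write v) ∧ x.1 = Tag.inc t w := by
  obtain ⟨p, op, hact, hst⟩ := hx.started hC2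
  obtain ⟨q, hq⟩ := ha
  rw [hact] at hq
  cases hq
  obtain ⟨hv, t, w, rfl, ht⟩ := hst.tag_of_write
  exact ⟨hv, t, w, hact, ht⟩

/-- Different writes have different tags. -/
theorem HasPair.eq_of_tag_eq (hξ : ξ.DistinctReconfigs) (hC1 : ∀ c, ξ.C1 c) (hC2 : ∀ c, ξ.C2 c)
    {a b : ℕ} {x y : Tag W × V} {v v' : V} (hx : ξ.HasPair a x) (hy : ξ.HasPair b y)
    (ha : ξ.IsWrite a v) (hb : ξ.IsWrite b v') (hxy : x.1 = y.1) : a = b := by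
  obtain ⟨-, t, w, ha', hx'⟩ := hx.of_write hC2 ha
  obtain ⟨-, t', w', hb', hy'⟩ := hy.of_write hC2 hb
  obtain rfl : w = w' := Tag.inc_writer (hx'.symm.trans (hxy.trans hy'))
  rcases lt_trichotomy a b with h | h | h
  · exact absurd hxy
      ((hx.le_of_precedes hξ hC1 hC2 hy (precedes_of_lt ha' hb' h)).2 ⟨_, hb⟩).ne
  · exact h
  · exact absurd hxy.symm
      ((hy.le_of_precedes hξ hC1 hC2 hx (precedes_of_lt hb' ha' h)).2 ⟨_, ha⟩).ne

/-- The order of the operations: by tag, and a write comes before the reads with the same tag. -/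
def TagPrec (ξ : Execution W R G A) (a b : ℕ) : Prop :=
  ∃ x y, ξ.HasPair a x ∧ ξ.HasPair b y ∧
    (x.1 < y.1 ∨ x.1 = y.1 ∧ (∃ v, ξ.IsWrite a v) ∧ ¬ ∃ v, ξ.IsWrite b v)

theorem TagPrec.trans {a b c : ℕ} (h : ξ.TagPrec a b) (h' : ξ.TagPrec b c) : ξ.TagPrec a c := by
  obtain ⟨x, y, hx, hy, h⟩ := h
  obtain ⟨y', z, hy', hz, h'⟩ := h'
  obtain rfl := hy.unique hy'
  refine ⟨x, z, hx, hz, ?_⟩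
  rcases h with h | ⟨h, hw, hb⟩ <;> rcases h' with h' | ⟨h', hw', hr'⟩
  · exact .inl (h.trans h')
  · exact .inl (h.trans_eq h')
  · exact .inl (h.trans_lt h')
  · exact absurd hw' hb

theorem tagPrec_irrefl (a : ℕ) : ¬ ξ.TagPrec a a := by
  rintro ⟨x, y, hx, hy, h⟩
  obtain rfl := hx.unique hy
  rcases h with h | ⟨-, hw, hn⟩
  · exact lt_irrefl _ h
  · exact hn hw

end Execution

end Ares

/-- Every execution of ARES in which the data access primitives of each configuration satisfy C1
and C2 is atomic. -/
theorem mainTheorem1 {S C V W R G : Type*} [LinearOrder W] (A : Ares.System S C V)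
    (ξ : Ares.Execution W R G A) (hdistinct : ξ.DistinctReconfigs)
    (hC1 : ∀ c, ξ.C1 c) (hC2 : ∀ c, ξ.C2 c) : ξ.Atomic := by
  have read_pair : ∀ {a v}, ξ.ReadReturns a v →
      ∃ x, v = x.2 ∧ ξ.HasPair a x ∧ ξ.Sourced x ∧ ¬ ∃ v, ξ.IsWrite a v := by
    rintro a v ⟨j, h⟩
    obtain ⟨p, x, hr, hx, hst, -⟩ := h.finished hC2 (by simp)
    obtain ⟨_, _, _, _, _, _, _, _, hsrc⟩ := hst
    refine ⟨x, Option.some.inj hr, hx, hsrc, ?_⟩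
    rintro ⟨v', q, hq⟩
    obtain ⟨p', hp', -⟩ := h
    rw [hp'] at hq
    cases hq
  let Ops : Set ℕ :=
    {a | (∃ v, ξ.ReadReturns a v) ∨ (∃ v, ξ.IsWrite a v) ∧ ∃ x, ξ.HasPair a x}
  have hpair : ∀ a ∈ Ops, ∃ x, ξ.HasPair a x := by
    rintro a (⟨v, h⟩ | ⟨-, h⟩)
    · obtain ⟨x, -, hx, -⟩ := read_pair h
      exact ⟨x, hx⟩
    · exact h
  refine ⟨Ops, ξ.TagPrec, ?_, ?_, ?_, fun a _ => Ares.Execution.tagPrec_irrefl a,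
    fun a _ b _ c _ => Ares.Execution.TagPrec.trans, ?_, ?_, ?_⟩
  · rintro a (h | ⟨h, -⟩)
    · exact .inl h
    · exact .inr h
  · intro a j r h
    obtain ⟨p, x, rfl, -⟩ := h.finished hC2 (by simp)
    exact .inl ⟨x.2, j, h⟩
  · intro a j v r h
    obtain ⟨p, x, -, hx, -⟩ := h.finished hC2 (by simp)
    obtain ⟨p, hp, -⟩ := h
    exact .inr ⟨⟨v, p, hp⟩, x, hx⟩
  · rintro a - b - hab ⟨y, x, hy, hx, h⟩
    have hle := hx.le_of_precedes hdistinct hC1 hC2 hy hab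
    rcases h with h | ⟨h, hw, -⟩
    · exact not_le.mpr h hle.1
    · exact (hle.2 hw).ne' h
  · rintro a ha b hb hab ⟨v, hw⟩
    obtain ⟨x, hx⟩ := hpair a ha
    obtain ⟨y, hy⟩ := hpair b hb
    rcases lt_trichotomy x.1 y.1 with h | h | h
    · exact .inl ⟨x, y, hx, hy, .inl h⟩
    · refine .inl ⟨x, y, hx, hy, .inr ⟨h, ⟨v, hw⟩, ?_⟩⟩
      rintro ⟨v', hw'⟩
      exact hab (hx.eq_of_tag_eq hdistinct hC1 hC2 hy hw hw' h)
    · exact .inr ⟨y, x, hy, hx, .inl h⟩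
  · intro b hb v hread
    obtain ⟨y, rfl, hy, hsrc, hnw⟩ := read_pair hread
    rcases hsrc with rfl | ⟨a, v, hw, hx⟩
    · -- no write has a tag as small as the initial one
      refine .inr ⟨rfl, ?_⟩
      rintro a' - ⟨v', hw'⟩ ⟨x', y', hx', hy', h⟩
      obtain rfl := hy.unique hy'
      obtain ⟨-, t, w, -, ht⟩ := hx'.of_write hC2 hw'
      have h0 := Ares.tag0_lt_inc t w
      rw [← ht] at h0
      rcases h with h | ⟨h, -⟩
      · exact lt_asymm h h0
      · exact h0.ne' h
    · obtain ⟨rfl, -⟩ := hx.of_write hC2 hw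
      refine .inl ⟨a, .inr ⟨⟨_, hw⟩, y, hx⟩, hw, ⟨y, y, hx, hy, .inr ⟨rfl, ⟨_, hw⟩, hnw⟩⟩, ?_⟩
      rintro a' - ⟨v', hw'⟩ ⟨x', y', hx', hy', h⟩
      obtain rfl := hy.unique hy'
      rcases h with h | ⟨h, -⟩
      · exact .inr ⟨x', y, hx', hx, .inl h⟩
      · exact .inl (hx'.eq_of_tag_eq hdistinct hC1 hC2 hx hw' hw h)
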